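/- Let $-\tfrac12<b<0$, let $p\ge 1$ be an integer, and let $\nu$ be the probability measure $\tau\,[\sin(\theta/2)]^{2b}\,d\theta$, $0\le\theta\le 2\pi$, on the unit circle $\partial\mathbb D$ (with $z=e^{i\theta}$), where $\tau$ is the normalization constant. Let $\mu$ be the $p$-sieved version of $\nu$: for each $j=0,\dots,p-1$ it consists of a copy of $\nu$, rescaled by $\theta\mapsto(\theta+2\pi j)/p$ to the arc $2\pi j/p\le\theta<2\pi(j+1)/p$ and given total mass $1/p$. For a Borel probability measure $m$ on $\partial\mathbb D$ with infinite support let $\Phi_n(\cdot;m)$ and $\varphi_n(\cdot;m)$ be its monic orthogonal and its orthonormal polynomials (Gram–Schmidt applied to $1,z,z^2,\dots$ in $L^2(m)$), let $\alpha_n(m)=-\overline{\Phi_{n+1}(0;m)}$ be its Verblunsky coefficients, and put $\vec\varphi(z;m)=(\varphi_0(z;m),\varphi_1(z;m),\dots)$. For $|\lambda|=1$ the Alexandrov measure $\mu^{(\lambda)}$ is the probability measure on $\partial\mathbb D$ with infinite support whose Verblunsky coefficients are $\lambda\,\alpha_n(\mu)$, $n\ge 0$. Write $\vec\varphi(z)=\vec\varphi(z;\mu)$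 and $\vec\varphi^{(\lambda)}(z)=\vec\varphi(z;\mu^{(\lambda)})$. For sequences $x,y\in\ell^\infty(\mathbb N)$ let $x\cdot y=\lim_{n\to\infty}\sum_{j=0}^n\overline{x_j}\,y_j$ whenever this limit exists. Let $|\lambda|=1$, $\lambda\ne\pm1$. Then the measures $\mu^{(\lambda)}$ and $\mu^{(\bar\lambda)}$ exist, and for every $u$ with $u^p=1$ the state $\vec\varphi(u)$ is balanced with respect to the families $$\{\vec\varphi^{(\lambda)}(w)\}_{w\in\partial\mathbb D,\ w^p\neq1}\quad\text{and}\quad\{\vec\varphi^{(\bar\lambda)}(w)\}_{w\in\partial\mathbb D,\ w^p\neq1}.$$ That is, $\vec\varphi(u)$ and all the vectors of the two families belong to $\ell^\infty(\mathbb N)$, the inner products $\vec\varphi(u)\cdot\vec\varphi^{(\lambda)}(w)$ and $\vec\varphi(u)\cdot\vec\varphi^{(\bar\lambda)}(w)$ converge for all $w\in\partial\mathbb D$ with $w^p\ne1$, and the sets $$\{|\vec\varphi(u)\cdot\vec\varphi^{(\lambda)}(w)|\}_{w\in\partial\mathbb D,\ w^p\neq1}\quad\text{and}\quad\{|\vec\varphi(u)\cdot\vec\varphi^{(\bar\lambda)}(w)|\}_{w\in\partial\mathbb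 D,\ w^p\neq1}$$ are the same. -/

import Mathlib

open MeasureTheory Filter Topology Polynomial ComplexConjugate
open scoped ENNReal

noncomputable section

namespace OPUC

/-- The circle carries its Borel σ-algebra. -/
instance instMeasurableSpaceCircle : MeasurableSpace Circle := borel Circle

instance instBorelSpaceCircle : BorelSpace Circle := ⟨rfl⟩

/-- The inner product `∫ conj (P z) * Q z dμ(z)` of two polynomials in `L²(μ)`. -/
def polyInner (μ : Measure Circle) (P Q : ℂ[X]) : ℂ :=
  ∫ z : Circle, conj (P.eval (z : ℂ)) * Q.eval (z : ℂ) ∂μ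

/-- The monic orthogonal polynomials `Φ_n(z; μ)`, by Gram-Schmidt (without normalization)
applied to `1, z, z², …` in `L²(μ)`. -/
def monicOP (μ : Measure Circle) (n : ℕ) : ℂ[X] :=
  X ^ n - ∑ k : Fin n,
    C (polyInner μ (monicOP μ k) (X ^ n) / polyInner μ (monicOP μ k) (monicOP μ k)) * monicOP μ k
termination_by n
decreasing_by exact k.2

/-- The orthonormal polynomials `φ_n(z; μ) = Φ_n(z; μ) / ‖Φ_n‖` in `L²(μ)`. -/
def orthonormalOP (μ : Measure Circle) (n : ℕ) : ℂ[X] :=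
  C (((Real.sqrt (∫ z : Circle, ‖(monicOP μ n).eval (z : ℂ)‖ ^ 2 ∂μ))⁻¹ : ℝ) : ℂ) * monicOP μ n

/-- The Verblunsky coefficients, `α_n(μ) = -conj (Φ_{n+1}(0; μ))`. -/
def verblunsky (μ : Measure Circle) (n : ℕ) : ℂ :=
  -conj ((monicOP μ (n + 1)).eval 0)

/-- The generalized vector `(φ_0(z), φ_1(z), φ_2(z), …)`. -/
def opVec (μ : Measure Circle) (z : ℂ) : ℕ → ℂ :=
  fun n => (orthonormalOP μ n).eval z

/-- A Borel probability measure on the unit circle with infinite support. -/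
def IsNontrivialProb (μ : Measure Circle) : Prop :=
  IsProbabilityMeasure μ ∧ μ.support.Infinite

/-- `m` is the Alexandrov measure `μ^(lam)`: the nontrivial probability measure on the circle
with Verblunsky coefficients `lam * α_n(μ)`. -/
def IsAlexandrov (μ : Measure Circle) (lam : ℂ) (m : Measure Circle) : Prop :=
  IsNontrivialProb m ∧ ∀ n, verblunsky m n = lam * verblunsky μ n

/-- The angle of a point of the circle, in `[0, 2π)`. -/
def angle (z : Circle) : ℝ :=
  toIcoMod Real.two_pi_pos 0 (Complex.arg (z : ℂ))

/-- The `p`-sieved version of `μ`: for each `j < p`, a copy of `μ` rescaled to the arc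
`[2πj/p, 2π(j+1)/p)` and given total mass `1/p` (when `μ` has mass one). -/
def sieve (p : ℕ) (μ : Measure Circle) : Measure Circle :=
  ∑ j ∈ Finset.range p,
    (p : ℝ≥0∞)⁻¹ • μ.map (fun z => Circle.exp ((angle z + 2 * Real.pi * j) / p))

/-- The normalization constant `τ` of the weight `sin(θ/2)^(2b)` on `[0, 2π]`. -/
def sinNorm (b : ℝ) : ℝ :=
  (∫ θ in (0 : ℝ)..(2 * Real.pi), Real.sin (θ / 2) ^ (2 * b))⁻¹

/-- The measure `τ sin(θ/2)^(2b) dθ`, `0 ≤ θ < 2π`, carried to the circle by `θ ↦ e^{iθ}`. -/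
def sinMeasure (b : ℝ) : Measure Circle :=
  ((volume.restrict (Set.Ico (0 : ℝ) (2 * Real.pi))).withDensity
    (fun θ => ENNReal.ofReal (sinNorm b * Real.sin (θ / 2) ^ (2 * b)))).map Circle.exp

/-- The (conditionally convergent) inner product `x · y = lim_n ∑_{j<n} conj (x_j) y_j` exists and
equals `s`. -/
def HasInner (x y : ℕ → ℂ) (s : ℂ) : Prop :=
  Tendsto (fun n => ∑ j ∈ Finset.range n, conj (x j) * y j) atTop (𝓝 s)

/-- `x` is a bounded sequence, that is, a vector of `ℓ^∞(ℕ)`. -/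
def IsBoundedSeq (x : ℕ → ℂ) : Prop :=
  ∃ M : ℝ, ∀ n, ‖x n‖ ≤ M

/-- The state `χ` is balanced with respect to the families `A` and `B` of generalized vectors:
all vectors lie in `ℓ^∞`, all the inner products `χ · A i` and `χ · B k` converge, and the two
sets of their absolute values are the same. -/
def IsBalanced {ι κ : Type*} (χ : ℕ → ℂ) (A : ι → ℕ → ℂ) (B : κ → ℕ → ℂ) : Prop :=
  IsBoundedSeq χ ∧ (∀ i, IsBoundedSeq (A i)) ∧ (∀ k, IsBoundedSeq (B k)) ∧
    ∃ (a : ι → ℂ) (c : κ → ℂ),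
      (∀ i, HasInner χ (A i) (a i)) ∧ (∀ k, HasInner χ (B k) (c k)) ∧
        Set.range (fun i => ‖a i‖) = Set.range (fun k => ‖c k‖)

end OPUC

end

/-! Everything rests on a Christoffel–Darboux identity mixing `μ` with `μ^(λ)`
(`sum_conj_szegoFun_mul`). If `(φ_n, φ_n^*)` solves the Szegő recursion for `λα`, then `(φ_n, λ̄
φ_n^*)` solves the one for `α`, started from `(1, λ̄)` instead of `(1, 1)`. Hence `(1 - ū w) ∑_{j<n}
conj φ_j(u) φ_j^(λ)(w)` equals the constant `1 - λ̄` plus a boundary term bilinear in the degree-`n`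
values at `u` and `w`.

For `u^p = 1` the values at `u` tend to zero (`tendsto_szegoFun_one`), and for `w^p ≠ 1` those at
`w` stay bounded (`isBoundedSeq_szegoFun`). So the inner product is `(1 - λ̄)/(1 - ū w)`, and its
modulus is unchanged when `λ` is replaced by `λ̄`, for each `w` separately.

Both estimates use explicit coefficients. Integration by parts gives a two-term recursion for the
moments of `ν`, whence `α_n(ν) = -b/(n+1+b)` (`isOrth_of_moments`). Sieving spreads these out with
`p - 1` zeros before each one, so that `Φ_{np+j}(z) = z^j Φ_n(z^p; ν)`; the estimates at `u` and `w`
reduce to estimates at `1` and at `w^p ≠ 1`.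

The Alexandrov measures exist by Verblunsky's theorem, obtained as a weak limit of Bernstein–Szegő
measures. Conversely, the Szegő recursion determines the polynomials of any measure with the
prescribed coefficients. -/

noncomputable section

namespace OPUC

/-! ### The Szegő recursion and its reversed polynomials -/

/-- The pair `(Φ_n, Φ_n^*)` generated by the Szegő recursion with coefficients `a`. -/
def szegoPair (a : ℕ → ℂ) : ℕ → ℂ[X] × ℂ[X]
  | 0 => (1, 1)
  | n + 1 =>
    (X * (szegoPair a n).1 - C (conj (a n)) * (szegoPair a n).2,
      (szegoPair a n).2 - C (a n) * (X * (szegoPair a n).1))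

/-- The monic polynomial `Φ_n` of the Szegő recursion. -/
def szego (a : ℕ → ℂ) (n : ℕ) : ℂ[X] := (szegoPair a n).1

/-- The reversed polynomial `Φ_n^*` of the Szegő recursion. -/
def szegoStar (a : ℕ → ℂ) (n : ℕ) : ℂ[X] := (szegoPair a n).2

@[simp] lemma szego_zero (a : ℕ → ℂ) : szego a 0 = 1 := rfl

@[simp] lemma szegoStar_zero (a : ℕ → ℂ) : szegoStar a 0 = 1 := rfl

lemma szego_succ (a : ℕ → ℂ) (n : ℕ) :
    szego a (n + 1) = X * szego a n - C (conj (a n)) * szegoStar a n := rfl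

lemma szegoStar_succ (a : ℕ → ℂ) (n : ℕ) :
    szegoStar a (n + 1) = szegoStar a n - C (a n) * (X * szego a n) := rfl

lemma szegoStar_eval_zero (a : ℕ → ℂ) (n : ℕ) : (szegoStar a n).eval 0 = 1 := by
  induction n with
  | zero => simp
  | succ n ih => simp [szegoStar_succ, ih]

lemma szego_succ_eval_zero (a : ℕ → ℂ) (n : ℕ) : (szego a (n + 1)).eval 0 = -conj (a n) := by
  simp [szego_succ, szegoStar_eval_zero]

lemma szego_natDegree_le (a : ℕ → ℂ) (n : ℕ) :
    (szego a n).Monic ∧ (szego a n).natDegree = n ∧ (szegoStar a n).natDegree ≤ n := by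
  induction n with
  | zero => simp
  | succ n ih =>
    obtain ⟨h1, h2, h3⟩ := ih
    have hX : (X * szego a n).Monic := monic_X.mul h1
    have hXd : (X * szego a n).natDegree = n + 1 := by
      rw [monic_X.natDegree_mul h1, h2, natDegree_X, add_comm]
    have hlt : (C (conj (a n)) * szegoStar a n).degree < (X * szego a n).degree := by
      rw [degree_eq_natDegree hX.ne_zero, hXd]
      refine lt_of_le_of_lt (degree_le_of_natDegree_le
        ((natDegree_C_mul_le _ _).trans h3)) ?_
      exact_mod_cast Nat.lt_succ_self n
    have hd : (szego a (n + 1)).degree = (X * szego a n).degree := by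
      rw [szego_succ, degree_sub_eq_left_of_degree_lt hlt]
    refine ⟨?_, ?_, ?_⟩
    · rw [szego_succ]; exact hX.sub_of_left hlt
    · rw [natDegree_eq_of_degree_eq hd, hXd]
    · rw [szegoStar_succ]
      refine (natDegree_sub_le _ _).trans (max_le (h3.trans n.le_succ) ?_)
      exact (natDegree_C_mul_le _ _).trans hXd.le

lemma szego_monic (a : ℕ → ℂ) (n : ℕ) : (szego a n).Monic := (szego_natDegree_le a n).1

lemma szego_natDegree (a : ℕ → ℂ) (n : ℕ) : (szego a n).natDegree = n :=
  (szego_natDegree_le a n).2.1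

lemma szegoStar_natDegree (a : ℕ → ℂ) (n : ℕ) : (szegoStar a n).natDegree ≤ n :=
  (szego_natDegree_le a n).2.2

lemma mul_conj_eq_one {z : ℂ} (hz : ‖z‖ = 1) : z * conj z = 1 := by
  rw [Complex.mul_conj, Complex.normSq_eq_norm_sq, hz]; simp

/-- On the unit circle, `Φ_n^*(z) = z^n conj (Φ_n(z))`. -/
lemma szegoStar_eval (a : ℕ → ℂ) (n : ℕ) {z : ℂ} (hz : ‖z‖ = 1) :
    (szegoStar a n).eval z = z ^ n * conj ((szego a n).eval z) := by
  induction n with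
  | zero => simp
  | succ n ih =>
    have h := mul_conj_eq_one hz
    have h' : z ^ n * conj z ^ n = 1 := by rw [← mul_pow, h, one_pow]
    simp only [szegoStar_succ, szego_succ, eval_sub, eval_mul, eval_C, eval_X, ih, map_sub,
      map_mul, map_pow, Complex.conj_conj]
    linear_combination (-(z ^ n * conj ((szego a n).eval z))) * h +
      a n * z * ((szego a n).eval z) * h'

lemma norm_szegoStar_eval (a : ℕ → ℂ) (n : ℕ) {z : ℂ} (hz : ‖z‖ = 1) :
    ‖(szegoStar a n).eval z‖ = ‖(szego a n).eval z‖ := by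
  rw [szegoStar_eval a n hz]; simp [hz]

/-- `Φ_n^*` has no zeros in the closed unit disc. -/
lemma szegoStar_eval_ne_zero {a : ℕ → ℂ} (ha : ∀ n, ‖a n‖ < 1) (n : ℕ) {z : ℂ} (hz : ‖z‖ ≤ 1) :
    (szegoStar a n).eval z ≠ 0 := by
  -- The bound `|Φ_n| ≤ |Φ_n^*|` on the closed disc is carried along, since it is what keeps `a n *
  -- z * Φ_n` strictly smaller than `Φ_n^*`.
  suffices h : (szegoStar a n).eval z ≠ 0 ∧
      ‖(szego a n).eval z‖ ≤ ‖(szegoStar a n).eval z‖ from h.1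
  induction n with
  | zero => simp
  | succ n ih =>
    obtain ⟨h1, h2⟩ := ih
    simp only [szegoStar_succ, szego_succ, eval_sub, eval_mul, eval_C, eval_X]
    set x := (szego a n).eval z
    set y := (szegoStar a n).eval z
    have hy : 0 < ‖y‖ := norm_pos_iff.2 h1
    have hzx : ‖z * x‖ ≤ ‖y‖ := by
      rw [norm_mul]; exact (mul_le_of_le_one_left (norm_nonneg _) hz).trans h2
    constructor
    · intro h
      have h3 : y = a n * (z * x) := sub_eq_zero.1 h
      have h4 : ‖y‖ ≤ ‖a n‖ * ‖y‖ := by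
        conv_lhs => rw [h3, norm_mul]
        gcongr
      nlinarith [ha n]
    · have key : ‖y - a n * (z * x)‖ ^ 2 - ‖z * x - conj (a n) * y‖ ^ 2 =
          (1 - ‖a n‖ ^ 2) * (‖y‖ ^ 2 - ‖z * x‖ ^ 2) := by
        simp only [← Complex.normSq_eq_norm_sq, Complex.normSq_apply, Complex.sub_re,
          Complex.sub_im, Complex.mul_re, Complex.mul_im, Complex.conj_re, Complex.conj_im]
        ring
      have h5 : 0 ≤ (1 - ‖a n‖ ^ 2) * (‖y‖ ^ 2 - ‖z * x‖ ^ 2) := by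
        apply mul_nonneg
        · nlinarith [ha n, norm_nonneg (a n)]
        · nlinarith [norm_nonneg (z * x)]
      exact le_of_sq_le_sq (by linarith) (norm_nonneg _)

/-! ### The inner product of polynomials -/

lemma integrable_of_continuous (m : Measure Circle) [IsFiniteMeasure m] {f : Circle → ℂ}
    (hf : Continuous f) : Integrable f m := by
  simpa using hf.continuousOn.integrableOn_compact (μ := m) isCompact_univ

lemma continuous_eval_circle (P : ℂ[X]) : Continuous fun z : Circle => P.eval (z : ℂ) :=
  P.continuous.comp (by fun_prop)

lemma integrable_polyInner (m : Measure Circle) [IsFiniteMeasure m] (P Q : ℂ[X]) :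
    Integrable (fun z : Circle => conj (P.eval (z : ℂ)) * Q.eval (z : ℂ)) m :=
  integrable_of_continuous m
    ((Complex.continuous_conj.comp (continuous_eval_circle P)).mul (continuous_eval_circle Q))

section

variable (m : Measure Circle)

lemma polyInner_add_right [IsFiniteMeasure m] (P Q R : ℂ[X]) :
    polyInner m P (Q + R) = polyInner m P Q + polyInner m P R := by
  simp only [polyInner, eval_add, mul_add]
  exact integral_add (integrable_polyInner m P Q) (integrable_polyInner m P R)

lemma polyInner_sub_right [IsFiniteMeasure m] (P Q R : ℂ[X]) :
    polyInner m P (Q - R) = polyInner m P Q - polyInner m P R := by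
  simp only [polyInner, eval_sub, mul_sub]
  exact integral_sub (integrable_polyInner m P Q) (integrable_polyInner m P R)

lemma polyInner_C_mul_right (c : ℂ) (P Q : ℂ[X]) :
    polyInner m P (C c * Q) = c * polyInner m P Q := by
  simp only [polyInner, eval_mul, eval_C]
  rw [← integral_const_mul]
  congr with z; ring

lemma polyInner_conj_symm (P Q : ℂ[X]) : polyInner m Q P = conj (polyInner m P Q) := by
  simp only [polyInner]
  rw [← integral_conj]
  congr with z; simp [mul_comm]

lemma polyInner_sum_right [IsFiniteMeasure m] {ι : Type*} (s : Finset ι) (P : ℂ[X]) (f : ι → ℂ[X]) :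
    polyInner m P (∑ i ∈ s, f i) = ∑ i ∈ s, polyInner m P (f i) := by
  simp only [polyInner, eval_finsetSum, Finset.mul_sum]
  exact integral_finsetSum _ fun i _ => integrable_polyInner m P (f i)

lemma polyInner_X_mul (P Q : ℂ[X]) : polyInner m (X * P) (X * Q) = polyInner m P Q := by
  simp only [polyInner, eval_mul, eval_X, map_mul]
  congr with z
  linear_combination conj (P.eval (z : ℂ)) * Q.eval (z : ℂ) * mul_conj_eq_one z.norm_coe

lemma polyInner_self (P : ℂ[X]) :
    polyInner m P P = ((∫ z : Circle, ‖P.eval (z : ℂ)‖ ^ 2 ∂m : ℝ) : ℂ) := by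
  simp only [polyInner]
  rw [← integral_complex_ofReal]
  congr with z
  rw [mul_comm, Complex.mul_conj, Complex.normSq_eq_norm_sq]

/-- A polynomial orthogonal to `1, …, z^{n-1}` is orthogonal to all polynomials of degree
less than `n`. -/
lemma polyInner_eq_zero_of_natDegree_lt [IsFiniteMeasure m] {n : ℕ} {Q : ℂ[X]}
    (h : ∀ j < n, polyInner m (X ^ j) Q = 0) {P : ℂ[X]} (hP : P.natDegree < n) :
    polyInner m P Q = 0 := by
  rw [polyInner_conj_symm m Q P, P.as_sum_range_C_mul_X_pow, polyInner_sum_right, map_sum]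
  refine Finset.sum_eq_zero fun i hi => ?_
  have hi' : i < n := (Finset.mem_range_succ_iff.1 hi).trans_lt hP
  rw [polyInner_C_mul_right, map_mul, ← polyInner_conj_symm, h i hi', mul_zero]

/-- `Φ_n` is orthogonal to `1, …, z^{n-1}`. -/
def IsOrth (m : Measure Circle) (a : ℕ → ℂ) (n : ℕ) : Prop :=
  ∀ j < n, polyInner m (X ^ j) (szego a n) = 0

lemma polyInner_szegoStar {a : ℕ → ℂ} {n j : ℕ} (hj : j ≤ n) :
    polyInner m (X ^ j) (szegoStar a n) = conj (polyInner m (X ^ (n - j)) (szego a n)) := by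
  simp only [polyInner]
  rw [← integral_conj]
  congr with z
  have hz := mul_conj_eq_one z.norm_coe
  have h' : (z : ℂ) ^ j * conj (z : ℂ) ^ j = 1 := by rw [← mul_pow, hz, one_pow]
  rw [szegoStar_eval a n z.norm_coe]
  simp only [eval_pow, eval_X, map_pow, map_mul, Complex.conj_conj]
  conv_lhs => rw [← Nat.add_sub_cancel' hj, pow_add]
  rw [Nat.add_sub_cancel' hj]
  linear_combination ((z : ℂ) ^ (n - j) * conj ((szego a n).eval (z : ℂ))) * h'

lemma IsOrth.polyInner_szegoStar_eq_zero {a : ℕ → ℂ} {n : ℕ} (h : IsOrth m a n) {j : ℕ} (h1 : 1 ≤ j)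
    (hj : j ≤ n) : polyInner m (X ^ j) (szegoStar a n) = 0 := by
  rw [polyInner_szegoStar m hj, h _ (by omega), map_zero]

lemma IsOrth.polyInner_eq_zero [IsFiniteMeasure m] {a : ℕ → ℂ} {n : ℕ} (h : IsOrth m a n) {P : ℂ[X]}
    (hP : P.natDegree < n) : polyInner m P (szego a n) = 0 :=
  polyInner_eq_zero_of_natDegree_lt m h hP

/-- The squared norm of `Φ_n` is `∏ (1 - |a_k|²)`. -/
lemma polyInner_szego_self [IsProbabilityMeasure m] {a : ℕ → ℂ} (h : ∀ n, IsOrth m a n) (n : ℕ) :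
    polyInner m (szego a n) (szego a n) =
      ((∏ k ∈ Finset.range n, (1 - ‖a k‖ ^ 2) : ℝ) : ℂ) := by
  induction n with
  | zero => simp [polyInner]
  | succ n ih =>
    have hstar : polyInner m (szegoStar a n) (szegoStar a n) =
        polyInner m (szego a n) (szego a n) := by
      rw [polyInner_self, polyInner_self]
      simp only [norm_szegoStar_eval a n (Circle.norm_coe _)]
    -- Pythagoras: multiplication by `z` is isometric, and `zΦ_n = Φ_{n+1} + ā_n Φ_n^*` is an
    -- orthogonal sum because `Φ_n^*` has degree at most `n`.
    have e1 : szego a (n + 1) + C (conj (a n)) * szegoStar a n = X * szego a n := by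
      rw [szego_succ]; ring
    have o1 : polyInner m (szegoStar a n) (szego a (n + 1)) = 0 :=
      (h (n + 1)).polyInner_eq_zero m (Nat.lt_succ_of_le (szegoStar_natDegree a n))
    have o2 : polyInner m (szego a (n + 1)) (szegoStar a n) = 0 := by
      rw [polyInner_conj_symm m (szegoStar a n), o1, map_zero]
    have key := polyInner_X_mul m (szego a n) (szego a n)
    rw [← e1, polyInner_add_right, polyInner_C_mul_right,
      polyInner_conj_symm m (szego a (n + 1)) (_ + _),
      polyInner_conj_symm m (szegoStar a n) (_ + _), polyInner_add_right, polyInner_add_right,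
      polyInner_C_mul_right, polyInner_C_mul_right, o1, o2, hstar] at key
    simp only [map_mul, mul_zero, add_zero, zero_add, Complex.conj_conj] at key
    rw [ih] at key
    rw [← polyInner_conj_symm] at key
    rw [Finset.prod_range_succ]
    rw [Complex.conj_ofReal] at key
    push_cast at key ⊢
    have hn : (conj (a n)) * a n = (‖a n‖ : ℂ) ^ 2 := by
      rw [mul_comm, Complex.mul_conj, Complex.normSq_eq_norm_sq]; push_cast; rfl
    linear_combination key - (∏ k ∈ Finset.range n, (1 - (‖a k‖ : ℂ) ^ 2)) * hn

/-- The polynomials of degree less than `n` are spanned by the first `n` members of a family of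
monic polynomials of degrees `0, 1, 2, …`. -/
lemma exists_eq_sum_of_monic {Q : ℕ → ℂ[X]} (hQ : ∀ n, (Q n).Monic)
    (hQd : ∀ n, (Q n).natDegree = n) {n : ℕ} {P : ℂ[X]} (hP : P.degree < n) :
    ∃ c : Fin n → ℂ, P = ∑ k : Fin n, C (c k) * Q k := by
  induction n generalizing P with
  | zero => exact ⟨fun _ => 0, by simpa using hP⟩
  | succ n ih =>
    have hd : (P - C (P.coeff n) * Q n).degree < n := by
      rw [degree_lt_iff_coeff_zero] at hP ⊢
      intro k hk
      rw [coeff_sub, coeff_C_mul]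
      rcases hk.eq_or_lt with rfl | hk
      · have := (hQ n).coeff_natDegree
        rw [hQd] at this
        rw [this, mul_one, sub_self]
      · rw [hP k hk, coeff_eq_zero_of_natDegree_lt (p := Q n) (by rwa [hQd]), mul_zero, sub_zero]
    obtain ⟨c, hc⟩ := ih hd
    refine ⟨Fin.snoc c (P.coeff n), ?_⟩
    simp only [Fin.sum_univ_castSucc, Fin.snoc_castSucc, Fin.snoc_last, Fin.val_castSucc,
      Fin.val_last]
    rw [← hc]; ring

lemma degree_X_pow_sub_lt {n : ℕ} {P : ℂ[X]} (hP : P.Monic) (hd : P.natDegree = n) :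
    ((X : ℂ[X]) ^ n - P).degree < (n : WithBot ℕ) := by
  rw [degree_lt_iff_coeff_zero]
  intro k hk
  rw [coeff_sub, coeff_X_pow]
  rcases hk.eq_or_lt with rfl | hk
  · have := hP.coeff_natDegree
    rw [hd] at this
    simp [this]
  · rw [if_neg hk.ne', coeff_eq_zero_of_natDegree_lt (by rwa [hd]), sub_zero]

lemma prod_one_sub_pos {a : ℕ → ℂ} (ha : ∀ n, ‖a n‖ < 1) (n : ℕ) :
    0 < ∏ k ∈ Finset.range n, (1 - ‖a k‖ ^ 2) :=
  Finset.prod_pos fun k _ => by nlinarith [ha k, norm_nonneg (a k)]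

/-- If the polynomials of a Szegő recursion are orthogonal, they are the monic orthogonal
polynomials of the measure. -/
lemma monicOP_eq_szego [IsProbabilityMeasure m] {a : ℕ → ℂ} (ha : ∀ n, ‖a n‖ < 1)
    (h : ∀ n, IsOrth m a n) (n : ℕ) : monicOP m n = szego a n := by
  induction n using Nat.strong_induction_on with
  | _ n ih =>
    obtain ⟨c, hc⟩ := exists_eq_sum_of_monic (szego_monic a) (szego_natDegree a)
      (degree_X_pow_sub_lt (szego_monic a n) (szego_natDegree a n))
    have hX : (X : ℂ[X]) ^ n = szego a n + ∑ k : Fin n, C (c k) * szego a k := by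
      rw [← hc]; ring
    have hcoef : ∀ k : Fin n, polyInner m (szego a k) (X ^ n) =
        c k * polyInner m (szego a k) (szego a k) := by
      intro k
      rw [hX, polyInner_add_right, polyInner_sum_right,
        (h n).polyInner_eq_zero m (by rw [szego_natDegree]; exact k.2), zero_add,
        Finset.sum_eq_single k]
      · rw [polyInner_C_mul_right]
      · intro l _ hl
        rw [polyInner_C_mul_right]
        rcases lt_or_gt_of_ne (fun h => hl (Fin.ext h) : (l : ℕ) ≠ k) with hlt | hlt
        · rw [polyInner_conj_symm m (szego a l) (szego a k),
            (h k).polyInner_eq_zero m (by rwa [szego_natDegree]), map_zero, mul_zero]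
        · rw [(h l).polyInner_eq_zero m (by rwa [szego_natDegree]), mul_zero]
      · simp
    rw [monicOP]
    rw [sub_eq_iff_eq_add]
    refine hX.trans ?_
    congr 1
    refine Finset.sum_congr rfl fun k _ => ?_
    rw [ih k k.2, hcoef k, mul_div_cancel_right₀]
    rw [polyInner_szego_self m h]
    exact_mod_cast (prod_one_sub_pos ha k).ne'

lemma verblunsky_eq [IsProbabilityMeasure m] {a : ℕ → ℂ} (ha : ∀ n, ‖a n‖ < 1)
    (h : ∀ n, IsOrth m a n) (n : ℕ) : verblunsky m n = a n := by
  rw [verblunsky, monicOP_eq_szego m ha h, szego_succ_eval_zero]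
  simp

lemma opVec_eq [IsProbabilityMeasure m] {a : ℕ → ℂ} (ha : ∀ n, ‖a n‖ < 1)
    (h : ∀ n, IsOrth m a n) (z : ℂ) (n : ℕ) :
    opVec m z n =
      (szego a n).eval z / (Real.sqrt (∏ k ∈ Finset.range n, (1 - ‖a k‖ ^ 2)) : ℝ) := by
  have hn := polyInner_szego_self m h n
  rw [polyInner_self] at hn
  rw [opVec, orthonormalOP, monicOP_eq_szego m ha h, Complex.ofReal_injective hn]
  simp [div_eq_inv_mul]

/-- A measure for which all `Φ_n` have positive norm has infinite support. -/
lemma support_infinite [IsProbabilityMeasure m] {a : ℕ → ℂ} (ha : ∀ n, ‖a n‖ < 1)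
    (h : ∀ n, IsOrth m a n) : m.support.Infinite := by
  intro hfin
  -- A monic `Q` of degree `d` vanishing on the support has `⟨Φ_d, Q⟩ = 0`. But `Q - Φ_d` has lower
  -- degree, so this inner product is `‖Φ_d‖² > 0`.
  let Q : ℂ[X] := ∏ z ∈ hfin.toFinset, (X - C (z : ℂ))
  have hQm : Q.Monic := monic_prod_of_monic _ _ fun z _ => monic_X_sub_C _
  have hQ : ∀ᵐ z : Circle ∂m, Q.eval (z : ℂ) = 0 := by
    filter_upwards [Measure.support_mem_ae (μ := m)] with z hz
    simp only [Q, eval_prod]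
    exact Finset.prod_eq_zero (hfin.mem_toFinset.2 hz) (by simp)
  have h0 : polyInner m (szego a Q.natDegree) Q = 0 := by
    rw [polyInner, ← integral_zero Circle ℂ (μ := m)]
    refine integral_congr_ae ?_
    filter_upwards [hQ] with z hz
    simp [hz]
  have hd : (Q - szego a Q.natDegree).degree < (Q.natDegree : WithBot ℕ) := by
    have h1 := degree_X_pow_sub_lt hQm rfl
    have h2 := degree_X_pow_sub_lt (szego_monic a Q.natDegree) (szego_natDegree a _)
    have h3 : Q - szego a Q.natDegree =
        (X ^ Q.natDegree - szego a Q.natDegree) - (X ^ Q.natDegree - Q) := by ring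
    rw [h3]
    exact (degree_sub_le _ _).trans_lt (max_lt h2 h1)
  obtain ⟨c, hc⟩ := exists_eq_sum_of_monic (szego_monic a) (szego_natDegree a) hd
  have h4 : Q = szego a Q.natDegree + ∑ k : Fin Q.natDegree, C (c k) * szego a k := by
    rw [← hc]; ring
  have h5 : polyInner m (szego a Q.natDegree)
      (∑ k : Fin Q.natDegree, C (c k) * szego a k) = 0 := by
    rw [polyInner_sum_right]
    refine Finset.sum_eq_zero fun k _ => ?_
    rw [polyInner_C_mul_right, polyInner_conj_symm m (szego a k),
      (h _).polyInner_eq_zero m (by rw [szego_natDegree]; exact k.2), map_zero, mul_zero]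
  have h6 : polyInner m (szego a Q.natDegree) (szego a Q.natDegree) = 0 := by
    rw [← h0]
    conv_rhs => rw [h4]
    rw [polyInner_add_right, ← h4, h5, add_zero]
  rw [polyInner_szego_self m h] at h6
  exact (prod_one_sub_pos ha Q.natDegree).ne' (by exact_mod_cast h6)

end

/-! ### From Gram–Schmidt to the Szegő recursion -/

/-- A nonzero polynomial has positive norm for a measure with infinite support. -/
lemma eq_zero_of_polyInner_self {m : Measure Circle} (hm : IsNontrivialProb m) {P : ℂ[X]}
    (hP : polyInner m P P = 0) : P = 0 := by
  have := hm.1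
  by_contra hne
  rw [polyInner_self, Complex.ofReal_eq_zero] at hP
  have hcont : Continuous fun z : Circle => ‖P.eval (z : ℂ)‖ ^ 2 :=
    (continuous_eval_circle P).norm.pow 2
  have hint : Integrable (fun z : Circle => ‖P.eval (z : ℂ)‖ ^ 2) m := by
    simpa using hcont.continuousOn.integrableOn_compact (μ := m) isCompact_univ
  have hae := (integral_eq_zero_iff_of_nonneg (fun z => by positivity) hint).1 hP
  have hcl : IsClosed {z : Circle | P.eval (z : ℂ) = 0} :=
    isClosed_eq (continuous_eval_circle P) continuous_const
  have hsub : m.support ⊆ {z : Circle | P.eval (z : ℂ) = 0} := by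
    refine Measure.support_subset_of_isClosed hcl ?_
    filter_upwards [hae] with z hz
    simpa using hz
  refine hm.2 (Set.Finite.subset ?_ hsub)
  have hfin : {z : ℂ | P.eval z = 0}.Finite := by
    refine (P.roots.toFinset.finite_toSet).subset fun z hz => ?_
    simpa [hne] using hz
  exact hfin.preimage Circle.coe_injective.injOn

lemma monicOP_degree (m : Measure Circle) (n : ℕ) :
    (monicOP m n).Monic ∧ (monicOP m n).natDegree = n := by
  induction n using Nat.strong_induction_on with
  | _ n ih =>
    rw [monicOP]
    set S := ∑ k : Fin n, C (polyInner m (monicOP m k) (X ^ n) /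
      polyInner m (monicOP m k) (monicOP m k)) * monicOP m k
    have hS : S.degree < ((X : ℂ[X]) ^ n).degree := by
      rw [degree_X_pow]
      refine (degree_sum_le _ _).trans_lt ?_
      refine (Finset.sup_lt_iff (WithBot.bot_lt_coe n)).2 ?_
      intro k _
      refine lt_of_le_of_lt (degree_le_of_natDegree_le
        ((natDegree_C_mul_le _ _).trans (ih k k.2).2.le)) ?_
      exact WithBot.coe_lt_coe.2 k.2
    refine ⟨(monic_X_pow n).sub_of_left hS, ?_⟩
    rw [natDegree_eq_of_degree_eq (degree_sub_eq_left_of_degree_lt hS), natDegree_X_pow]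

lemma polyInner_monicOP_of_lt {m : Measure Circle} (hm : IsNontrivialProb m) {k n : ℕ}
    (hk : k < n) : polyInner m (monicOP m k) (monicOP m n) = 0 := by
  have := hm.1
  induction n using Nat.strong_induction_on generalizing k with
  | _ n ih =>
    rw [monicOP.eq_1 m n, polyInner_sub_right, polyInner_sum_right,
      Finset.sum_eq_single (⟨k, hk⟩ : Fin n)]
    · rw [polyInner_C_mul_right, div_mul_cancel₀, sub_self]
      exact fun h0 => (monicOP_degree m k).1.ne_zero (eq_zero_of_polyInner_self hm h0)
    · intro l _ hl
      rw [polyInner_C_mul_right]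
      rcases lt_or_gt_of_ne (fun h => hl (Fin.ext h) : (l : ℕ) ≠ k) with hlt | hlt
      · rw [polyInner_conj_symm m (monicOP m l) (monicOP m k), ih k hk hlt, map_zero, mul_zero]
      · rw [ih l l.2 hlt, mul_zero]
    · simp

lemma polyInner_X_pow_monicOP {m : Measure Circle} (hm : IsNontrivialProb m) {j n : ℕ}
    (hj : j < n) : polyInner m (X ^ j) (monicOP m n) = 0 := by
  have := hm.1
  obtain ⟨c, hc⟩ := exists_eq_sum_of_monic (fun k => (monicOP_degree m k).1)
    (fun k => (monicOP_degree m k).2) (n := n) (P := X ^ j)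
    (by rw [degree_X_pow]; exact_mod_cast hj)
  rw [hc, polyInner_conj_symm m (monicOP m n), polyInner_sum_right, map_sum]
  refine Finset.sum_eq_zero fun k _ => ?_
  rw [polyInner_C_mul_right, map_mul, ← polyInner_conj_symm, polyInner_monicOP_of_lt hm k.2,
    mul_zero]

/-- The Szegő recursion. -/
theorem monicOP_eq_szego_verblunsky {m : Measure Circle} (hm : IsNontrivialProb m) (n : ℕ) :
    monicOP m n = szego (verblunsky m) n := by
  have := hm.1
  induction n with
  | zero => rw [monicOP]; simp
  | succ n ih =>
    set a := verblunsky m with ha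
    have horth : IsOrth m a n := fun j hj => by rw [← ih]; exact polyInner_X_pow_monicOP hm hj
    -- The difference vanishes at `0` by the choice of `a n`, so it is `X * E` with `E` of degree
    -- below `n`. Removing the factor `X` makes `E` orthogonal to `1, …, X^(n-1)`, hence to itself.
    set D := szego a (n + 1) - monicOP m (n + 1) with hD
    have hD0 : D.eval 0 = 0 := by
      rw [hD, eval_sub, szego_succ_eval_zero, ha, verblunsky]; simp
    obtain ⟨E, hE⟩ : X ∣ D := by rwa [X_dvd_iff, coeff_zero_eq_eval_zero]
    have hDdeg : D.degree < ((n + 1 : ℕ) : WithBot ℕ) := by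
      have h1 := degree_X_pow_sub_lt (szego_monic a (n + 1)) (szego_natDegree a _)
      have h2 := degree_X_pow_sub_lt (monicOP_degree m (n + 1)).1 (monicOP_degree m (n + 1)).2
      have h3 : D = (X ^ (n + 1) - monicOP m (n + 1)) - (X ^ (n + 1) - szego a (n + 1)) := by
        rw [hD]; ring
      rw [h3]
      exact (degree_sub_le _ _).trans_lt (max_lt h2 h1)
    have hEorth : ∀ j < n, polyInner m (X ^ j) E = 0 := by
      intro j hj
      rw [← polyInner_X_mul, ← hE, ← pow_succ', hD, polyInner_sub_right,
        polyInner_X_pow_monicOP hm (by omega), szego_succ, polyInner_sub_right,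
        polyInner_C_mul_right, horth.polyInner_szegoStar_eq_zero m (by omega) (by omega), pow_succ',
        polyInner_X_mul, horth j hj]
      simp
    have hE0 : E = 0 := by
      by_contra hne
      have hdeg : E.natDegree < n := by
        have h1 : D ≠ 0 := by rw [hE]; exact mul_ne_zero X_ne_zero hne
        have h2 : D.natDegree < n + 1 := (natDegree_lt_iff_degree_lt h1).2 hDdeg
        rw [hE, natDegree_X_mul hne] at h2
        omega
      exact hne (eq_zero_of_polyInner_self hm
        (polyInner_eq_zero_of_natDegree_lt m hEorth hdeg))
    rw [hE0, mul_zero] at hE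
    exact (sub_eq_zero.1 (hD ▸ hE)).symm

lemma isOrth_verblunsky {m : Measure Circle} (hm : IsNontrivialProb m) (n : ℕ) :
    IsOrth m (verblunsky m) n := fun j hj => by
  rw [← monicOP_eq_szego_verblunsky hm]; exact polyInner_X_pow_monicOP hm hj

/-! ### Bernstein–Szegő measures and Verblunsky's theorem -/

/-- Orthogonality of `Φ_{n+1}` implies orthogonality of `Φ_n`. -/
lemma IsOrth.of_succ {m : Measure Circle} [IsFiniteMeasure m] {a : ℕ → ℂ} {n : ℕ}
    (ha : ‖a n‖ < 1) (h : IsOrth m a (n + 1)) : IsOrth m a n := by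
  intro j hj
  -- The Szegő recursion run backwards; `|a n| < 1` makes the factor invertible.
  have e : C (1 - conj (a n) * a n) * (X * szego a n) =
      szego a (n + 1) + C (conj (a n)) * szegoStar a (n + 1) := by
    rw [szego_succ, szegoStar_succ, C_sub, C_mul, C_1]; ring
  have h1 : (1 - conj (a n) * a n) * polyInner m (X ^ j) (szego a n) = 0 := by
    rw [← polyInner_X_mul, ← polyInner_C_mul_right, e, ← pow_succ', polyInner_add_right,
      polyInner_C_mul_right, h _ (by omega), h.polyInner_szegoStar_eq_zero m (by omega) (by omega)]
    simp
  refine (mul_eq_zero.1 h1).resolve_left fun h0 => ?_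
  rw [mul_comm, Complex.mul_conj, Complex.normSq_eq_norm_sq] at h0
  have h2 : 1 - ‖a n‖ ^ 2 = 0 := by exact_mod_cast h0
  nlinarith [norm_nonneg (a n)]

lemma IsOrth.of_le {m : Measure Circle} [IsFiniteMeasure m] {a : ℕ → ℂ} {k n : ℕ}
    (ha : ∀ n, ‖a n‖ < 1) (hk : k ≤ n) (h : IsOrth m a n) : IsOrth m a k := by
  induction n, hk using Nat.le_induction with
  | base => exact h
  | succ n _ ih => exact ih (h.of_succ (ha n))

/-- Arc length on the circle. -/
def arcLength : Measure Circle :=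
  (volume.restrict (Set.Ioc (0 : ℝ) (2 * Real.pi))).map Circle.exp

lemma measurable_circle_exp : Measurable Circle.exp := Circle.exp.continuous.measurable

instance : IsFiniteMeasure arcLength := by
  unfold arcLength; infer_instance

lemma arcLength_ne_zero : arcLength ≠ 0 := by
  intro h
  have h1 : arcLength Set.univ = 0 := by rw [h]; simp
  rw [arcLength, Measure.map_apply measurable_circle_exp MeasurableSet.univ] at h1
  simp [Real.pi_pos.not_ge] at h1

lemma integral_arcLength {f : Circle → ℂ} (hf : Continuous f) :
    ∫ z, f z ∂arcLength = ∫ θ in (0 : ℝ)..2 * Real.pi, f (Circle.exp θ) := by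
  rw [arcLength, integral_map measurable_circle_exp.aemeasurable hf.aestronglyMeasurable,
    intervalIntegral.integral_of_le Real.two_pi_pos.le]

/-- The Bernstein–Szegő measure, up to normalization. -/
def bernsteinSzego (a : ℕ → ℂ) (n : ℕ) : Measure Circle :=
  arcLength.withDensity fun z => ENNReal.ofReal (‖(szegoStar a n).eval (z : ℂ)‖ ^ 2)⁻¹

lemma continuous_bernsteinSzego {a : ℕ → ℂ} (ha : ∀ n, ‖a n‖ < 1) (n : ℕ) :
    Continuous fun z : Circle => (‖(szegoStar a n).eval (z : ℂ)‖ ^ 2)⁻¹ :=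
  ((continuous_eval_circle _).norm.pow 2).inv₀ fun z =>
    pow_ne_zero 2 (norm_ne_zero_iff.2 (szegoStar_eval_ne_zero ha n z.norm_coe.le))

lemma isFiniteMeasure_bernsteinSzego {a : ℕ → ℂ} (ha : ∀ n, ‖a n‖ < 1) (n : ℕ) :
    IsFiniteMeasure (bernsteinSzego a n) := by
  refine isFiniteMeasure_withDensity_ofReal ?_
  have : Integrable (fun z : Circle => (‖(szegoStar a n).eval (z : ℂ)‖ ^ 2)⁻¹) arcLength := by
    simpa using (continuous_bernsteinSzego ha n).continuousOn.integrableOn_compact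
      (μ := arcLength) isCompact_univ
  exact this.2

lemma bernsteinSzego_ne_zero {a : ℕ → ℂ} (ha : ∀ n, ‖a n‖ < 1) (n : ℕ) :
    bernsteinSzego a n ≠ 0 := by
  intro h
  have h1 := (withDensity_eq_zero_iff
    (continuous_bernsteinSzego ha n).measurable.ennreal_ofReal.aemeasurable).1 h
  have h2 : ∀ᵐ z ∂arcLength, False := by
    filter_upwards [h1] with z hz
    have := szegoStar_eval_ne_zero ha n z.norm_coe.le
    have h3 : 0 < (‖(szegoStar a n).eval (z : ℂ)‖ ^ 2)⁻¹ := by positivity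
    simp only [Pi.zero_apply, ENNReal.ofReal_eq_zero] at hz
    linarith
  exact arcLength_ne_zero (by simpa using h2)

/-- On the circle `Φ_n = z^n conj Φ_n^*`, so `z̄^j Φ_n / |Φ_n^*|² = z^(n-j) / Φ_n^*`. One factor `z`
is absorbed by `dz = iz dθ`. The rest is analytic on the closed disc, because `j < n` and `Φ_n^*`
has no zeros there, and Cauchy's theorem applies. -/
lemma isOrth_bernsteinSzego {a : ℕ → ℂ} (ha : ∀ n, ‖a n‖ < 1) (n : ℕ) :
    IsOrth (bernsteinSzego a n) a n := by
  intro j hj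
  set g : ℂ → ℂ := fun z => z ^ (n - j - 1) / (szegoStar a n).eval z with hg
  have hcauchy : ∮ z in C(0, 1), g z = 0 := by
    refine Complex.circleIntegral_eq_zero_of_differentiable_on_off_countable zero_le_one
      Set.countable_empty ?_ ?_
    · refine ContinuousOn.div (by fun_prop) (Polynomial.continuousOn _) fun z hz => ?_
      exact szegoStar_eval_ne_zero ha n (by simpa using hz)
    · intro z hz
      refine DifferentiableAt.div (by fun_prop) (Polynomial.differentiableAt _) ?_
      have hz' : ‖z‖ < 1 := by simpa using hz
      exact szegoStar_eval_ne_zero ha n hz'.le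
  have hpt : ∀ z : Circle, (ENNReal.ofReal (‖(szegoStar a n).eval (z : ℂ)‖ ^ 2)⁻¹).toReal •
      (conj (((X : ℂ[X]) ^ j).eval (z : ℂ)) * (szego a n).eval (z : ℂ)) = z * g z := by
    intro z
    have hne := szegoStar_eval_ne_zero ha n z.norm_coe.le
    have hz := mul_conj_eq_one z.norm_coe
    have hstar := szegoStar_eval a n z.norm_coe
    have hzne : (z : ℂ) ≠ 0 := z.coe_ne_zero
    rw [ENNReal.toReal_ofReal (by positivity), Complex.real_smul]
    push_cast
    have hns : ((‖(szegoStar a n).eval (z : ℂ)‖ : ℂ)) ^ 2 =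
        (szegoStar a n).eval (z : ℂ) * conj ((szegoStar a n).eval (z : ℂ)) := by
      rw [Complex.mul_conj, Complex.normSq_eq_norm_sq]; push_cast; rfl
    have hsz : (szego a n).eval (z : ℂ) = (z : ℂ) ^ n * conj ((szegoStar a n).eval (z : ℂ)) := by
      have h' : (z : ℂ) ^ n * conj (z : ℂ) ^ n = 1 := by rw [← mul_pow, hz, one_pow]
      rw [hstar]
      simp only [map_mul, map_pow, Complex.conj_conj]
      linear_combination (-(szego a n).eval (z : ℂ)) * h'
    have hc : conj ((szegoStar a n).eval (z : ℂ)) ≠ 0 := by simpa using hne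
    have hpow : (z : ℂ) ^ n = z ^ j * (z * z ^ (n - j - 1)) := by
      rw [← pow_succ', ← pow_add]; congr 1; omega
    have h'' : (z : ℂ) ^ j * conj (z : ℂ) ^ j = 1 := by rw [← mul_pow, hz, one_pow]
    rw [hns, hsz, hpow, hg]
    simp only [eval_pow, eval_X, map_pow]
    field_simp
    linear_combination h''
  rw [polyInner, bernsteinSzego, integral_withDensity_eq_integral_toReal_smul
    (continuous_bernsteinSzego ha n).measurable.ennreal_ofReal (by simp)]
  simp_rw [hpt]
  rw [integral_arcLength]
  · rw [circleIntegral] at hcauchy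
    simp only [deriv_circleMap, smul_eq_mul] at hcauchy
    have h2 : ∀ θ : ℝ, circleMap 0 1 θ * Complex.I * g (circleMap 0 1 θ) =
        Complex.I * ((Circle.exp θ : ℂ) * g (Circle.exp θ)) := by
      intro θ
      simp only [circleMap, Circle.coe_exp, Complex.ofReal_one, one_mul, zero_add]
      ring
    simp_rw [h2] at hcauchy
    rw [intervalIntegral.integral_const_mul] at hcauchy
    exact (mul_eq_zero.1 hcauchy).resolve_left Complex.I_ne_zero
  · refine Continuous.mul (by fun_prop) ?_
    refine Continuous.div (by fun_prop) (continuous_eval_circle _) fun z => ?_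
    exact szegoStar_eval_ne_zero ha n z.norm_coe.le

lemma exists_prob_isOrth {a : ℕ → ℂ} (ha : ∀ n, ‖a n‖ < 1) (n : ℕ) :
    ∃ m : ProbabilityMeasure Circle, ∀ k ≤ n, IsOrth (m : Measure Circle) a k := by
  have := isFiniteMeasure_bernsteinSzego ha n
  have : NeZero (bernsteinSzego a n) := ⟨bernsteinSzego_ne_zero ha n⟩
  have hp : IsProbabilityMeasure ((bernsteinSzego a n Set.univ)⁻¹ • bernsteinSzego a n) :=
    inferInstance
  refine ⟨⟨_, hp⟩, fun k hk => IsOrth.of_le (m := (bernsteinSzego a n Set.univ)⁻¹ •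
    bernsteinSzego a n) ha hk fun j hj => ?_⟩
  have h := isOrth_bernsteinSzego ha n j hj
  simp only [polyInner] at h ⊢
  rw [integral_smul_measure, h, smul_zero]

/-- **Verblunsky's theorem** (existence): every sequence in the unit disc is the sequence of
Verblunsky coefficients of a nontrivial probability measure. -/
theorem exists_isNontrivialProb {a : ℕ → ℂ} (ha : ∀ n, ‖a n‖ < 1) :
    ∃ m : Measure Circle, IsNontrivialProb m ∧ ∀ n, verblunsky m n = a n := by
  choose M hM using exists_prob_isOrth ha
  -- Probability measures on the circle form a compact space, so the Bernstein–Szegő measures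
  -- converge weakly along a nonprincipal ultrafilter. Each orthogonality relation holds for all
  -- large indices and tests a continuous function, so it survives in the limit.
  obtain ⟨m, -, hm⟩ := isCompact_univ.ultrafilter_le_nhds
    ((hyperfilter ℕ).map M) (by simp)
  have hlim : Tendsto M (hyperfilter ℕ) (𝓝 m) := hm
  rw [ProbabilityMeasure.tendsto_iff_forall_integral_rclike_tendsto ℂ] at hlim
  have horth : ∀ n, IsOrth (m : Measure Circle) a n := by
    intro n j hj
    have hcont : Continuous fun z : Circle =>
        conj (((X : ℂ[X]) ^ j).eval (z : ℂ)) * (szego a n).eval (z : ℂ) :=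
      (Complex.continuous_conj.comp (continuous_eval_circle _)).mul (continuous_eval_circle _)
    have h1 := hlim (BoundedContinuousFunction.mkOfCompact ⟨_, hcont⟩)
    refine tendsto_nhds_unique h1 (tendsto_const_nhds.congr' ?_)
    have h2 : ∀ᶠ k in (hyperfilter ℕ : Filter ℕ), n ≤ k := by
      have h3 : ∀ᶠ k in (cofinite : Filter ℕ), n ≤ k := by
        rw [Nat.cofinite_eq_atTop]; exact eventually_ge_atTop n
      exact hyperfilter_le_cofinite h3
    filter_upwards [h2] with k hk
    exact (hM k n hk j hj).symm
  exact ⟨m, ⟨m.2, support_infinite _ ha horth⟩, verblunsky_eq _ ha horth⟩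

/-! ### Verblunsky coefficients from a two-term moment recursion -/

/-- The Laurent moment `∫ z^{-j} P(z) dm(z)`. -/
def laurentMoment (m : Measure Circle) (P : ℂ[X]) (j : ℤ) : ℂ :=
  ∫ z : Circle, (z : ℂ) ^ (-j) * P.eval (z : ℂ) ∂m

lemma continuous_zpow_circle (j : ℤ) : Continuous fun z : Circle => (z : ℂ) ^ j := by
  have : Continuous fun z : Circle => ((z ^ j : Circle) : ℂ) :=
    continuous_subtype_val.comp (continuous_zpow j)
  simpa using this

lemma integrable_laurentMoment (m : Measure Circle) [IsFiniteMeasure m] (P : ℂ[X]) (j : ℤ) :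
    Integrable (fun z : Circle => (z : ℂ) ^ (-j) * P.eval (z : ℂ)) m :=
  integrable_of_continuous m ((continuous_zpow_circle _).mul (continuous_eval_circle P))

lemma polyInner_X_pow_eq_laurentMoment (m : Measure Circle) (P : ℂ[X]) (j : ℕ) :
    polyInner m (X ^ j) P = laurentMoment m P j := by
  simp only [polyInner, laurentMoment]
  congr with z
  have h : conj (z : ℂ) = (z : ℂ)⁻¹ := by rw [← Circle.coe_inv, Circle.coe_inv_eq_conj]
  rw [eval_pow, eval_X, map_pow, h, zpow_neg, zpow_natCast, inv_pow]

lemma laurentMoment_szego_succ (m : Measure Circle) [IsFiniteMeasure m] (a : ℕ → ℂ) (n : ℕ)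
    (j : ℤ) : laurentMoment m (szego a (n + 1)) j =
      laurentMoment m (szego a n) (j - 1) - conj (a n) * laurentMoment m (szegoStar a n) j := by
  simp only [laurentMoment]
  rw [← integral_const_mul, ← integral_sub (integrable_laurentMoment m _ _)
    ((integrable_laurentMoment m _ _).const_mul _)]
  congr with z
  have h : (z : ℂ) ^ (-(j - 1)) = (z : ℂ) ^ (-j) * z := by
    rw [← zpow_add_one₀ z.coe_ne_zero]; congr 1; ring
  simp only [szego_succ, eval_sub, eval_mul, eval_X, eval_C, h]
  ring

lemma laurentMoment_szegoStar_succ (m : Measure Circle) [IsFiniteMeasure m] (a : ℕ → ℂ) (n : ℕ)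
    (j : ℤ) : laurentMoment m (szegoStar a (n + 1)) j =
      laurentMoment m (szegoStar a n) j - a n * laurentMoment m (szego a n) (j - 1) := by
  simp only [laurentMoment]
  rw [← integral_const_mul, ← integral_sub (integrable_laurentMoment m _ _)
    ((integrable_laurentMoment m _ _).const_mul _)]
  congr with z
  have h : (z : ℂ) ^ (-(j - 1)) = (z : ℂ) ^ (-j) * z := by
    rw [← zpow_add_one₀ z.coe_ne_zero]; congr 1; ring
  simp only [szegoStar_succ, eval_sub, eval_mul, eval_X, eval_C, h]
  ring

/-- The Verblunsky coefficients of the weight `|1 - z|^{2b}`. -/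
def jacobiCoeff (b : ℝ) (n : ℕ) : ℝ := -b / (n + 1 + b)

lemma int_sub_ne_zero {b : ℝ} (hb : -1 / 2 < b) (hb' : b < 0)
    (j : ℤ) : (j : ℂ) - b ≠ 0 := by
  intro h
  have h1 : ((j : ℝ) : ℂ) = (b : ℂ) := by push_cast; exact sub_eq_zero.1 h
  have h2 : (j : ℝ) = b := Complex.ofReal_injective h1
  have h3 : j < 0 := by exact_mod_cast h2.trans_lt hb'
  have h4 : (j : ℝ) ≤ -1 := by exact_mod_cast Int.le_sub_one_of_lt h3
  linarith

/-- The recursion alone transfers orthogonality of `Φ_n` to orthogonality of `Φ_{n+1}` to `z, …,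
z^n`. Only the zeroth moment of `Φ_{n+1}` needs the special coefficients, and its vanishing is what
dictates their value. -/
lemma isOrth_of_moments {b : ℝ} (hb : -1 / 2 < b) (hb' : b < 0)
    {m : Measure Circle} [IsFiniteMeasure m]
    (hm : ∀ j : ℤ, ((j : ℂ) - 1 - b) * laurentMoment m 1 (j - 1) =
      (b + j) * laurentMoment m 1 j) (n : ℕ) :
    IsOrth m (fun k => (jacobiCoeff b k : ℂ)) n := by
  set a : ℕ → ℂ := fun k => (jacobiCoeff b k : ℂ) with ha
  have hden : ∀ n : ℕ, (n : ℂ) + 1 + b ≠ 0 := by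
    intro n h
    have h1 : (n : ℝ) + 1 + b = 0 := by exact_mod_cast h
    have h2 : (0 : ℝ) ≤ n := n.cast_nonneg
    linarith
  have hconj : ∀ n, conj (a n) = a n := fun n => Complex.conj_ofReal _
  have haval : ∀ n : ℕ, ((n : ℂ) + 1 + b) * a n = -b := by
    intro n
    simp only [ha, jacobiCoeff]
    push_cast
    rw [mul_div_cancel₀ _ (hden n)]
  have hne : ∀ (n : ℕ) (j : ℤ), (j : ℂ) - n - 1 - b ≠ 0 := by
    intro n j
    have := int_sub_ne_zero hb hb' (j - n - 1)
    push_cast at this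
    exact this
  -- Two relations between the moments of `Φ_n` and `Φ_n^*` that propagate together. At `n = 0` the
  -- first is the hypothesis on `m` and the second is trivial.
  have key : ∀ n : ℕ, (∀ j : ℤ, ((j : ℂ) - n - 1 - b) * laurentMoment m (szego a n) (j - 1) =
      (b + j) * laurentMoment m (szegoStar a n) j) ∧
      (∀ j : ℤ, (j : ℂ) * laurentMoment m (szegoStar a n) j =
        (j - n) * laurentMoment m (szego a n) j) := by
    intro n
    induction n with
    | zero =>
      refine ⟨fun j => ?_, fun j => ?_⟩
      · simpa using hm j
      · simp
    | succ n ih =>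
      obtain ⟨i1, i2⟩ := ih
      -- Eliminating the shifted moment of `Φ_n` by `i1` expresses both moments at level `n + 1`
      -- through the single `j`-th moment of `Φ_n^*`.
      have e1 : ∀ j : ℤ, ((n : ℂ) + 1 + b) * ((j : ℂ) - n - 1 - b) *
          laurentMoment m (szego a (n + 1)) j =
          j * (n + 1 + 2 * b) * laurentMoment m (szegoStar a n) j := by
        intro j
        rw [laurentMoment_szego_succ, hconj]
        linear_combination ((n : ℂ) + 1 + b) * i1 j -
          ((j : ℂ) - n - 1 - b) * laurentMoment m (szegoStar a n) j * haval n
      have e2 : ∀ j : ℤ, ((n : ℂ) + 1 + b) * ((j : ℂ) - n - 1 - b) *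
          laurentMoment m (szegoStar a (n + 1)) j =
          (j - n - 1) * (n + 1 + 2 * b) * laurentMoment m (szegoStar a n) j := by
        intro j
        rw [laurentMoment_szegoStar_succ]
        linear_combination b * i1 j -
          ((j : ℂ) - n - 1 - b) * laurentMoment m (szego a n) (j - 1) * haval n
      have h0 : ∀ j : ℤ, ((n : ℂ) + 1 + b) * ((j : ℂ) - n - 1 - b) ≠ 0 :=
        fun j => mul_ne_zero (hden n) (hne n j)
      refine ⟨fun j => ?_, fun j => ?_⟩
      · apply mul_left_cancel₀ (h0 j)
        have e1' := e1 (j - 1)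
        have i2' := i2 (j - 1)
        push_cast at e1' i2' ⊢
        linear_combination ((j : ℂ) - n - 1 - b) * e1' - (b + j) * e2 j +
          ((j : ℂ) - n - 1 - b) * (n + 1 + 2 * b) * i2' +
          ((j : ℂ) - n - 1) * (n + 1 + 2 * b) * i1 j
      · apply mul_left_cancel₀ (h0 j)
        push_cast
        linear_combination (j : ℂ) * e2 j - ((j : ℂ) - n - 1) * e1 j
  have step : ∀ n : ℕ, laurentMoment m (szego a (n + 1)) 0 = 0 := by
    intro n
    obtain ⟨i1, -⟩ := key n
    have e := i1 0
    have h0 := mul_ne_zero (hden n) (hne n 0)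
    apply mul_left_cancel₀ h0
    rw [laurentMoment_szego_succ, hconj]
    push_cast at e ⊢
    linear_combination ((n : ℂ) + 1 + b) * e -
          ((0 : ℂ) - n - 1 - b) * laurentMoment m (szegoStar a n) 0 * haval n
  induction n with
  | zero => intro j hj; omega
  | succ n ih =>
    intro j hj
    rw [polyInner_X_pow_eq_laurentMoment]
    rcases Nat.eq_zero_or_pos j with rfl | hpos
    · exact step n
    · rw [laurentMoment_szego_succ]
      have h1 : laurentMoment m (szego a n) ((j : ℤ) - 1) = 0 := by
        have := ih (j - 1) (by omega)
        rw [polyInner_X_pow_eq_laurentMoment] at this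
        rwa [Nat.cast_sub hpos] at this
      have h2 := ih.polyInner_szegoStar_eq_zero m hpos (by omega)
      rw [polyInner_X_pow_eq_laurentMoment] at h2
      rw [h1, h2]; simp

/-! ### The weight `sin(θ/2)^{2b}` -/

/-- Jordan's inequality `sin(θ/2) ≥ θ/π` on `[0, π]` dominates the weight by a multiple of `θ^(2b)`,
integrable as `2b > -1`. The reflection `θ ↦ 2π - θ` handles the other half. -/
lemma intervalIntegrable_sin_rpow {b : ℝ} (hb : -1 / 2 < b) (hb' : b < 0) :
    IntervalIntegrable (fun θ => Real.sin (θ / 2) ^ (2 * b)) volume 0 (2 * Real.pi) := by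
  have hpi := Real.pi_pos
  have hmeas : Measurable fun θ : ℝ => Real.sin (θ / 2) ^ (2 * b) := by fun_prop
  have h1 : IntervalIntegrable (fun θ => Real.sin (θ / 2) ^ (2 * b)) volume 0 Real.pi := by
    have h0 : IntervalIntegrable (fun θ : ℝ => (Real.pi⁻¹) ^ (2 * b) * θ ^ (2 * b))
        volume 0 Real.pi :=
      (intervalIntegral.intervalIntegrable_rpow' (by linarith)).const_mul _
    refine h0.mono_fun hmeas.aestronglyMeasurable ?_
    rw [Set.uIoc_of_le hpi.le]
    refine (ae_restrict_iff' measurableSet_Ioc).2 (Eventually.of_forall fun θ hθ => ?_)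
    beta_reduce
    have hs : Real.pi⁻¹ * θ ≤ Real.sin (θ / 2) := by
      refine le_trans (le_of_eq ?_) (Real.mul_le_sin (x := θ / 2) (by linarith [hθ.1])
        (by linarith [hθ.2]))
      field_simp
    have hpos : 0 < Real.pi⁻¹ * θ := mul_pos (inv_pos.2 hpi) hθ.1
    rw [← Real.mul_rpow (inv_pos.2 hpi).le hθ.1.le,
      Real.norm_of_nonneg (Real.rpow_nonneg (hpos.le.trans hs) _),
      Real.norm_of_nonneg (Real.rpow_nonneg hpos.le _)]
    exact Real.rpow_le_rpow_of_nonpos hpos hs (by linarith)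
  have h2 : IntervalIntegrable (fun θ => Real.sin (θ / 2) ^ (2 * b)) volume
      Real.pi (2 * Real.pi) := by
    have h3 := h1.comp_sub_left (2 * Real.pi)
    have h4 : 2 * Real.pi - Real.pi = Real.pi := by ring
    rw [sub_zero, h4] at h3
    refine h3.symm.congr ?_
    intro θ _
    have h5 : (2 * Real.pi - θ) / 2 = Real.pi - θ / 2 := by ring
    simp only [h5, Real.sin_pi_sub]
  exact h1.trans h2

lemma intervalIntegrable_sin_rpow_mul {b : ℝ} (hb : -1 / 2 < b) (hb' : b < 0)
    {f : ℝ → ℂ} (hf : Continuous f) :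
    IntervalIntegrable (fun θ => ((Real.sin (θ / 2) ^ (2 * b) : ℝ) : ℂ) * f θ) volume
      0 (2 * Real.pi) :=
  IntervalIntegrable.mul_continuousOn ⟨(intervalIntegrable_sin_rpow hb hb').1.ofReal,
    (intervalIntegrable_sin_rpow hb hb').2.ofReal⟩ hf.continuousOn

lemma integral_sin_rpow_pos {b : ℝ} (hb : -1 / 2 < b) (hb' : b < 0) :
    0 < ∫ θ in (0 : ℝ)..(2 * Real.pi), Real.sin (θ / 2) ^ (2 * b) := by
  refine intervalIntegral.intervalIntegral_pos_of_pos_on (intervalIntegrable_sin_rpow hb hb')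
    (fun θ hθ => ?_) Real.two_pi_pos
  exact Real.rpow_pos_of_pos (Real.sin_pos_of_pos_of_lt_pi (by linarith [hθ.1])
    (by linarith [hθ.2])) _

/-- Integration by parts for the trigonometric moments of the weight. -/
lemma sin_rpow_moment {b : ℝ} (hb : -1 / 2 < b) (hb' : b < 0)
    (k : ℤ) :
    (b + k + 1) * (∫ θ in (0 : ℝ)..(2 * Real.pi), ((Real.sin (θ / 2) ^ (2 * b) : ℝ) : ℂ) *
        (Circle.exp θ : ℂ) ^ (k + 1)) =
      (k - b) * ∫ θ in (0 : ℝ)..(2 * Real.pi), ((Real.sin (θ / 2) ^ (2 * b) : ℝ) : ℂ) *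
        (Circle.exp θ : ℂ) ^ k := by
  set s : ℝ → ℂ := fun θ => ((Real.sin (θ / 2) ^ (2 * b) : ℝ) : ℂ) with hs
  set E : ℝ → ℂ := fun θ => (Circle.exp θ : ℂ) with hE
  have hEc : ∀ k : ℤ, Continuous fun θ => E θ ^ k := fun k =>
    (continuous_zpow_circle k).comp Circle.exp.continuous
  -- The primitive `sin(θ/2)^(2b+1) e^{i(k+1/2)θ}` vanishes at both ends because `2b + 1 > 0`. Its
  -- derivative combines exactly the integrands of orders `k` and `k + 1`.
  set F : ℝ → ℂ := fun θ => ((Real.sin (θ / 2) ^ (2 * b + 1) : ℝ) : ℂ) *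
    Complex.exp (((k : ℂ) + 1 / 2) * Complex.I * θ) with hF
  set F' : ℝ → ℂ := fun θ => (b + k + 1) / 2 * (s θ * E θ ^ (k + 1)) +
    (b - k) / 2 * (s θ * E θ ^ k) with hF'
  have hFcont : Continuous F := by
    refine Continuous.mul (Complex.continuous_ofReal.comp ?_) (by fun_prop)
    exact (by fun_prop : Continuous fun θ : ℝ => Real.sin (θ / 2)).rpow_const
      fun _ => Or.inr (by linarith)
  have hderiv : ∀ θ ∈ Set.Ioo (0 : ℝ) (2 * Real.pi), HasDerivAt F (F' θ) θ := by
    intro θ hθ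
    have hsin : 0 < Real.sin (θ / 2) :=
      Real.sin_pos_of_pos_of_lt_pi (by linarith [hθ.1]) (by linarith [hθ.2])
    have d1 : HasDerivAt (fun θ : ℝ => Real.sin (θ / 2)) (Real.cos (θ / 2) * (1 / 2)) θ :=
      ((hasDerivAt_id θ).div_const 2).sin
    have d2 := (d1.rpow_const (p := 2 * b + 1) (Or.inl hsin.ne')).ofReal_comp
    have d3 : HasDerivAt (fun θ : ℝ => Complex.exp (((k : ℂ) + 1 / 2) * Complex.I * θ))
        (Complex.exp (((k : ℂ) + 1 / 2) * Complex.I * θ) * (((k : ℂ) + 1 / 2) * Complex.I)) θ := by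
      have := ((Complex.ofRealCLM.hasDerivAt (x := θ)).const_mul
        (((k : ℂ) + 1 / 2) * Complex.I)).cexp
      simpa using this
    refine (d2.mul d3).congr_deriv ?_
    have hpow : Real.sin (θ / 2) ^ (2 * b + 1) = Real.sin (θ / 2) ^ (2 * b) * Real.sin (θ / 2) :=
      Real.rpow_add_one hsin.ne' _
    -- In terms of `h = e^{iθ/2}` the derivative identity becomes rational.
    set h : ℂ := Complex.exp (θ / 2 * Complex.I) with hh
    have hne : h ≠ 0 := Complex.exp_ne_zero _
    have hEh : E θ = h * h := by
      simp only [hE, Circle.coe_exp, hh]; rw [← Complex.exp_add]; congr 1; ring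
    have hexp : Complex.exp (((k : ℂ) + 1 / 2) * Complex.I * θ) = E θ ^ k * h := by
      simp only [hE, Circle.coe_exp, hh]
      rw [← Complex.exp_int_mul, ← Complex.exp_add]; congr 1; ring
    have hcos : ((Real.cos (θ / 2) : ℝ) : ℂ) = (h + h⁻¹) / 2 := by
      rw [hh, ← Complex.exp_neg, Complex.ofReal_cos, Complex.cos]; push_cast; ring_nf
    have hsn : ((Real.sin (θ / 2) : ℝ) : ℂ) = (h⁻¹ - h) * Complex.I / 2 := by
      rw [hh, ← Complex.exp_neg, Complex.ofReal_sin, Complex.sin]; push_cast; ring_nf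
    have hzp : E θ ^ (k + 1) = E θ ^ k * (h * h) := by
      rw [zpow_add_one₀ (by simp [hE]), hEh]
    have h21 : 2 * b + 1 - 1 = 2 * b := by ring
    simp only [hF', hs]
    rw [hpow, h21, hexp, hzp]
    simp only [Complex.ofReal_mul, Complex.ofReal_add, Complex.ofReal_div, Complex.ofReal_one,
      Complex.ofReal_ofNat]
    rw [hcos, hsn]
    field_simp
    ring_nf
    simp only [Complex.I_sq]
    ring
  have hint1 := intervalIntegrable_sin_rpow_mul hb hb' (hEc (k + 1))
  have hint0 := intervalIntegrable_sin_rpow_mul hb hb' (hEc k)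
  have hFTC := intervalIntegral.integral_eq_sub_of_hasDerivAt_of_le Real.two_pi_pos.le
    hFcont.continuousOn hderiv ((hint1.const_mul _).add (hint0.const_mul _))
  have hF0 : F 0 = 0 := by
    simp only [hF]; rw [zero_div, Real.sin_zero, Real.zero_rpow (by linarith)]; simp
  have hF1 : F (2 * Real.pi) = 0 := by
    simp only [hF]
    rw [mul_div_cancel_left₀ _ two_ne_zero, Real.sin_pi, Real.zero_rpow (by linarith)]; simp
  rw [hF0, hF1, hF'] at hFTC
  rw [intervalIntegral.integral_add (hint1.const_mul _) (hint0.const_mul _),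
    intervalIntegral.integral_const_mul, intervalIntegral.integral_const_mul] at hFTC
  linear_combination 2 * hFTC

lemma sinNorm_pos {b : ℝ} (hb : -1 / 2 < b) (hb' : b < 0) :
    0 < sinNorm b := inv_pos.2 (integral_sin_rpow_pos hb hb')

lemma measurable_sin_density (b : ℝ) :
    Measurable fun θ : ℝ => ENNReal.ofReal (sinNorm b * Real.sin (θ / 2) ^ (2 * b)) := by
  fun_prop

lemma sin_density_nonneg {b : ℝ} (hb : -1 / 2 < b) (hb' : b < 0)
    {θ : ℝ} (hθ : θ ∈ Set.Ico (0 : ℝ) (2 * Real.pi)) :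
    0 ≤ sinNorm b * Real.sin (θ / 2) ^ (2 * b) :=
  mul_nonneg (sinNorm_pos hb hb').le (Real.rpow_nonneg
    (Real.sin_nonneg_of_nonneg_of_le_pi (by linarith [hθ.1]) (by linarith [hθ.2])) _)

lemma integral_sinMeasure {b : ℝ} (hb : -1 / 2 < b) (hb' : b < 0)
    {f : Circle → ℂ} (hf : Continuous f) :
    ∫ z, f z ∂sinMeasure b = sinNorm b * ∫ θ in (0 : ℝ)..(2 * Real.pi),
      ((Real.sin (θ / 2) ^ (2 * b) : ℝ) : ℂ) * f (Circle.exp θ) := by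
  rw [sinMeasure, integral_map measurable_circle_exp.aemeasurable hf.aestronglyMeasurable,
    integral_withDensity_eq_integral_toReal_smul (measurable_sin_density b) (by simp),
    ← intervalIntegral.integral_const_mul, intervalIntegral.integral_of_le Real.two_pi_pos.le,
    integral_Ioc_eq_integral_Ioo, integral_Ico_eq_integral_Ioo]
  refine setIntegral_congr_fun measurableSet_Ioo fun θ hθ => ?_
  rw [ENNReal.toReal_ofReal (sin_density_nonneg hb hb' (Set.Ioo_subset_Ico_self hθ)),
    Complex.real_smul]
  push_cast; ring

lemma isProbabilityMeasure_sinMeasure {b : ℝ} (hb : -1 / 2 < b) (hb' : b < 0) :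
    IsProbabilityMeasure (sinMeasure b) := by
  constructor
  rw [sinMeasure, Measure.map_apply measurable_circle_exp MeasurableSet.univ, Set.preimage_univ,
    withDensity_apply _ MeasurableSet.univ, Measure.restrict_univ,
    ← ofReal_integral_eq_lintegral_ofReal]
  · rw [integral_const_mul, integral_Ico_eq_integral_Ioo, ← integral_Ioc_eq_integral_Ioo,
      ← intervalIntegral.integral_of_le Real.two_pi_pos.le, sinNorm,
      inv_mul_cancel₀ (integral_sin_rpow_pos hb hb').ne', ENNReal.ofReal_one]
  · refine Integrable.const_mul ?_ _
    have := (intervalIntegrable_sin_rpow hb hb').1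
    exact (integrableOn_Ico_iff_integrableOn_Ioo (by simp)).2
      ((integrableOn_Ioc_iff_integrableOn_Ioo (by simp)).1 this)
  · exact (ae_restrict_iff' measurableSet_Ico).2
      (Eventually.of_forall fun θ hθ => sin_density_nonneg hb hb' hθ)

lemma isOrth_sinMeasure {b : ℝ} (hb : -1 / 2 < b) (hb' : b < 0)
    (n : ℕ) :
    IsOrth (sinMeasure b) (fun k => (jacobiCoeff b k : ℂ)) n := by
  have := isProbabilityMeasure_sinMeasure hb hb'
  refine isOrth_of_moments hb hb' (fun j => ?_) n
  have hmom : ∀ j : ℤ, laurentMoment (sinMeasure b) 1 j =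
      sinNorm b * ∫ θ in (0 : ℝ)..(2 * Real.pi),
        ((Real.sin (θ / 2) ^ (2 * b) : ℝ) : ℂ) * (Circle.exp θ : ℂ) ^ (-j) := by
    intro j
    simp only [laurentMoment, eval_one, mul_one]
    exact integral_sinMeasure hb hb' (continuous_zpow_circle (-j))
  have h := sin_rpow_moment hb hb' (-j)
  have e : -(j - 1) = -j + 1 := by ring
  rw [hmom, hmom, e]
  push_cast at h ⊢
  linear_combination (-(sinNorm b : ℂ)) * h

/-! ### Sieving Verblunsky coefficients -/

/-- The sieved sequence: `a_n` at the places `(n + 1) p - 1`, zero elsewhere. -/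
def sieveCoeff (p : ℕ) (a : ℕ → ℂ) (k : ℕ) : ℂ :=
  if p ∣ k + 1 then a ((k + 1) / p - 1) else 0

lemma sieveCoeff_of_lt {p : ℕ} (a : ℕ → ℂ) (n : ℕ) {j : ℕ} (hj : j + 1 < p) :
    sieveCoeff p a (n * p + j) = 0 := by
  rw [sieveCoeff, if_neg]
  intro h
  rw [add_assoc, Nat.dvd_add_right (Dvd.intro_left n rfl)] at h
  exact absurd (Nat.le_of_dvd (by omega) h) (by omega)

lemma sieveCoeff_last {p : ℕ} (hp : 0 < p) (a : ℕ → ℂ) (n : ℕ) :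
    sieveCoeff p a (n * p + (p - 1)) = a n := by
  have h : n * p + (p - 1) + 1 = (n + 1) * p := by rw [add_mul]; omega
  rw [sieveCoeff, h, if_pos (Dvd.intro_left _ rfl), Nat.mul_div_cancel _ hp, Nat.add_sub_cancel]

lemma norm_sieveCoeff_lt (p : ℕ) {a : ℕ → ℂ} (ha : ∀ n, ‖a n‖ < 1) (k : ℕ) :
    ‖sieveCoeff p a k‖ < 1 := by
  rw [sieveCoeff]; split_ifs
  · exact ha _
  · simp

lemma mul_sieveCoeff (p : ℕ) (c : ℂ) (a : ℕ → ℂ) (k : ℕ) :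
    c * sieveCoeff p a k = sieveCoeff p (fun n => c * a n) k := by
  simp only [sieveCoeff]; split_ifs <;> simp

/-- A zero coefficient multiplies `Φ` by `z` and leaves `Φ^*` alone. After `p - 1` of them the next
step multiplies by `z · z^(p-1) = z^p`, which is one original step taken at `z^p`. -/
lemma szego_sieveCoeff {p : ℕ} (hp : 0 < p) (a : ℕ → ℂ) (n : ℕ) {j : ℕ} (hj : j < p) :
    szego (sieveCoeff p a) (n * p + j) = X ^ j * expand ℂ p (szego a n) ∧
      szegoStar (sieveCoeff p a) (n * p + j) = expand ℂ p (szegoStar a n) := by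
  induction n generalizing j with
  | zero =>
    induction j with
    | zero => simp
    | succ j ihj =>
      obtain ⟨h1, h2⟩ := ihj (by omega)
      rw [← add_assoc, szego_succ, szegoStar_succ, sieveCoeff_of_lt a 0 hj, h1, h2]
      simp [pow_succ']
  | succ n ih =>
    induction j with
    | zero =>
      obtain ⟨h1, h2⟩ := ih (j := p - 1) (by omega)
      have h : (n + 1) * p + 0 = n * p + (p - 1) + 1 := by rw [add_mul]; omega
      have hX : (X : ℂ[X]) ^ p = X * X ^ (p - 1) := by rw [← pow_succ']; congr 1; omega
      rw [h, szego_succ, szegoStar_succ, sieveCoeff_last hp, h1, h2, szego_succ a n,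
        szegoStar_succ a n]
      simp only [map_sub, map_mul, expand_X, expand_C, hX, pow_zero, one_mul]
      exact ⟨by ring, by ring⟩
    | succ j ihj =>
      obtain ⟨h1, h2⟩ := ihj (by omega)
      rw [← add_assoc, szego_succ, szegoStar_succ, sieveCoeff_of_lt a (n + 1) hj, h1, h2]
      refine ⟨?_, ?_⟩
      · simp only [map_zero, zero_mul, sub_zero]; ring
      · simp

/-! ### The sieved measure -/

lemma measurable_angle : Measurable angle := by
  have h : angle = fun z : Circle => Complex.arg (z : ℂ) -
      (⌊(Complex.arg (z : ℂ) - 0) / (2 * Real.pi)⌋ : ℝ) * (2 * Real.pi) := by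
    funext z
    rw [angle, toIcoMod, toIcoDiv_eq_floor, zsmul_eq_mul]
  rw [h]
  have hco : Continuous fun z : Circle => (z : ℂ) := by fun_prop
  have hc : Measurable fun z : Circle => Complex.arg (z : ℂ) :=
    Complex.measurable_arg.comp hco.measurable
  have hfl : Measurable fun x : ℝ => (⌊x⌋ : ℝ) := by
    exact (measurable_from_top (f := fun n : ℤ => (n : ℝ))).comp Int.measurable_floor
  exact hc.sub ((hfl.comp ((hc.sub_const 0).div_const _)).mul_const _)

lemma exp_angle (z : Circle) : Circle.exp (angle z) = z := by
  rw [angle, toIcoMod, Circle.periodic_exp.sub_zsmul_eq, Circle.exp_arg]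

/-- The `j`-th inverse branch of `z ↦ z^p`. -/
def sieveBranch (p j : ℕ) (z : Circle) : Circle :=
  Circle.exp ((angle z + 2 * Real.pi * j) / p)

lemma measurable_sieveBranch (p j : ℕ) : Measurable (sieveBranch p j) :=
  measurable_circle_exp.comp ((measurable_angle.add_const _).div_const _)

lemma sieveBranch_pow {p : ℕ} (hp : 0 < p) (j : ℕ) (z : Circle) :
    sieveBranch p j z ^ p = z := by
  have hp' : (p : ℝ) ≠ 0 := by exact_mod_cast hp.ne'
  rw [sieveBranch, ← Circle.exp_natCast_mul, mul_div_cancel₀ _ hp', Circle.exp_add, exp_angle]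
  have : Circle.exp (2 * Real.pi * j) = 1 := by
    rw [mul_comm]; simp
  rw [this, mul_one]

lemma coe_sieveBranch {p : ℕ} (j : ℕ) (z : Circle) :
    (sieveBranch p j z : ℂ) =
      sieveBranch p 0 z * Complex.exp (2 * Real.pi * Complex.I / p) ^ j := by
  simp only [sieveBranch, Circle.coe_exp]
  rw [← Complex.exp_nat_mul, ← Complex.exp_add]
  congr 1; push_cast; ring

lemma sieve_eq (p : ℕ) (m : Measure Circle) :
    sieve p m = ∑ j ∈ Finset.range p, (p : ℝ≥0∞)⁻¹ • m.map (sieveBranch p j) := rfl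

lemma isProbabilityMeasure_sieve {p : ℕ} (hp : 0 < p) (m : Measure Circle)
    [IsProbabilityMeasure m] : IsProbabilityMeasure (sieve p m) := by
  constructor
  have h : ∀ j, m.map (sieveBranch p j) Set.univ = 1 := by
    intro j
    rw [Measure.map_apply (measurable_sieveBranch p j) MeasurableSet.univ]
    simp
  simp only [sieve_eq, Measure.finsetSum_apply, Measure.smul_apply, h]
  simp only [smul_eq_mul, mul_one, Finset.sum_const, Finset.card_range, nsmul_eq_mul]
  exact ENNReal.mul_inv_cancel (by exact_mod_cast hp.ne') (by simp)

lemma integral_sieve (p : ℕ) (m : Measure Circle) [IsProbabilityMeasure m]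
    {f : Circle → ℂ} (hf : Continuous f) :
    ∫ z, f z ∂sieve p m = (p : ℂ)⁻¹ * ∑ j ∈ Finset.range p, ∫ z, f (sieveBranch p j z) ∂m := by
  rw [sieve_eq, integral_finsetSum_measure]
  · rw [Finset.mul_sum]
    refine Finset.sum_congr rfl fun j _ => ?_
    rw [integral_smul_measure, integral_map (measurable_sieveBranch p j).aemeasurable
      hf.aestronglyMeasurable]
    simp
  · intro j hj
    have hp : p ≠ 0 := by rintro rfl; simp at hj
    exact (integrable_of_continuous _ hf).smul_measure (by simpa using hp)

/-- The branches of the `p`-th root differ by powers of a primitive root of unity `ω`, so the moment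
carries the factor `∑ ω^{i(j-k)}`. It vanishes unless `p` divides `k - j`. In that case `k - j = pq`
with `0 ≤ q < n`, and each branch contributes the moment `⟨z^q, Φ_n⟩ = 0` of the original measure.
-/
lemma isOrth_sieve {p : ℕ} (hp : 0 < p) {m : Measure Circle} [IsProbabilityMeasure m] {a : ℕ → ℂ}
    (h : ∀ n, IsOrth m a n) (N : ℕ) : IsOrth (sieve p m) (sieveCoeff p a) N := by
  intro k hk
  obtain ⟨n, j, hj, rfl⟩ : ∃ n j, j < p ∧ N = n * p + j :=
    ⟨N / p, N % p, Nat.mod_lt _ hp, (Nat.div_add_mod' N p).symm⟩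
  rw [polyInner_X_pow_eq_laurentMoment, (szego_sieveCoeff hp a n hj).1]
  set Q := szego a n
  have hf : Continuous fun z : Circle =>
      (z : ℂ) ^ (-(k : ℤ)) * (X ^ j * expand ℂ p Q).eval (z : ℂ) :=
    (continuous_zpow_circle _).mul (continuous_eval_circle _)
  rw [laurentMoment, integral_sieve p m hf]
  have hpt : ∀ (i : ℕ) (z : Circle), (sieveBranch p i z : ℂ) ^ (-(k : ℤ)) *
      (X ^ j * expand ℂ p Q).eval (sieveBranch p i z : ℂ) =
      (sieveBranch p i z : ℂ) ^ ((j : ℤ) - k) * Q.eval (z : ℂ) := by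
    intro i z
    have h1 : (sieveBranch p i z : ℂ) ^ p = z := by
      exact_mod_cast congrArg (fun w : Circle => (w : ℂ)) (sieveBranch_pow hp i z)
    rw [eval_mul, eval_pow, eval_X, expand_eval, h1, sub_eq_add_neg, add_comm,
      zpow_add₀ (Circle.coe_ne_zero _), zpow_natCast]
    ring
  simp_rw [hpt]
  refine mul_eq_zero_of_right _ ?_
  by_cases hdvd : (p : ℤ) ∣ (k : ℤ) - j
  · obtain ⟨q, hq⟩ := hdvd
    have hp1 : (0 : ℤ) < p := by exact_mod_cast hp
    have hq0 : 0 ≤ q := by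
      have : -(p : ℤ) < p * q := by rw [← hq]; omega
      nlinarith
    have hqn : q < n := by
      have : (p : ℤ) * q < p * n := by
        rw [← hq]
        have : (k : ℤ) < n * p + j := by exact_mod_cast hk
        linarith [mul_comm (p : ℤ) n]
      exact lt_of_mul_lt_mul_left this hp1.le
    lift q to ℕ using hq0
    refine Finset.sum_eq_zero fun i _ => ?_
    have h2 := h n q (by exact_mod_cast hqn)
    rw [polyInner_X_pow_eq_laurentMoment] at h2
    rw [← h2, laurentMoment]
    congr with z
    have h1 : (sieveBranch p i z : ℂ) ^ p = z := by
      exact_mod_cast congrArg (fun w : Circle => (w : ℂ)) (sieveBranch_pow hp i z)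
    have h3 : (j : ℤ) - k = p * (-(q : ℤ)) := by linarith
    rw [h3, zpow_mul, zpow_natCast, h1]
  · set w : ℂ := Complex.exp (2 * Real.pi * Complex.I / p) with hw
    have hprim : IsPrimitiveRoot w p := Complex.isPrimitiveRoot_exp p hp.ne'
    have hne : w ^ ((j : ℤ) - k) ≠ 1 := by
      rw [Ne, hprim.zpow_eq_one_iff_dvd]
      intro h0
      exact hdvd (by rw [← neg_sub]; exact h0.neg_right)
    have h4 : ∀ i, ∫ z, (sieveBranch p i z : ℂ) ^ ((j : ℤ) - k) * Q.eval (z : ℂ) ∂m =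
        (w ^ ((j : ℤ) - k)) ^ i *
          ∫ z, (sieveBranch p 0 z : ℂ) ^ ((j : ℤ) - k) * Q.eval (z : ℂ) ∂m := by
      intro i
      rw [← integral_const_mul]
      congr with z
      rw [coe_sieveBranch i z, mul_zpow, ← zpow_natCast, ← zpow_natCast, ← zpow_mul, ← zpow_mul,
        mul_comm (i : ℤ)]
      ring
    rw [Finset.sum_congr rfl fun i _ => h4 i, ← Finset.sum_mul]
    refine mul_eq_zero_of_left ?_ _
    have h5 := geom_sum_mul (w ^ ((j : ℤ) - k)) p
    have h6 : (w ^ ((j : ℤ) - k)) ^ p = 1 := by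
      rw [← zpow_natCast, ← zpow_mul, mul_comm, zpow_mul, zpow_natCast, hprim.pow_eq_one, one_zpow]
    rw [h6, sub_self] at h5
    exact (mul_eq_zero.1 h5).resolve_right (sub_ne_zero.2 hne)

/-! ### Normalized polynomials -/

/-- The norm of `Φ_n`. -/
def szegoNorm (a : ℕ → ℂ) (n : ℕ) : ℝ := Real.sqrt (∏ k ∈ Finset.range n, (1 - ‖a k‖ ^ 2))

/-- The normalized polynomial `φ_n`, as a function. -/
def szegoFun (a : ℕ → ℂ) (z : ℂ) (n : ℕ) : ℂ := (szego a n).eval z / szegoNorm a n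

/-- The normalized reversed polynomial `φ_n^*`, as a function. -/
def szegoStarFun (a : ℕ → ℂ) (z : ℂ) (n : ℕ) : ℂ := (szegoStar a n).eval z / szegoNorm a n

lemma szegoNorm_pos {a : ℕ → ℂ} (ha : ∀ n, ‖a n‖ < 1) (n : ℕ) : 0 < szegoNorm a n :=
  Real.sqrt_pos.2 (prod_one_sub_pos ha n)

lemma szegoNorm_succ {a : ℕ → ℂ} (ha : ∀ n, ‖a n‖ < 1) (n : ℕ) :
    szegoNorm a (n + 1) = szegoNorm a n * Real.sqrt (1 - ‖a n‖ ^ 2) := by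
  rw [szegoNorm, Finset.prod_range_succ, Real.sqrt_mul (prod_one_sub_pos ha n).le, szegoNorm]

lemma sqrt_one_sub_pos {a : ℂ} (ha : ‖a‖ < 1) : 0 < Real.sqrt (1 - ‖a‖ ^ 2) :=
  Real.sqrt_pos.2 (by nlinarith [norm_nonneg a])

lemma szegoFun_succ {a : ℕ → ℂ} (ha : ∀ n, ‖a n‖ < 1) (z : ℂ) (n : ℕ) :
    (Real.sqrt (1 - ‖a n‖ ^ 2) : ℂ) * szegoFun a z (n + 1) =
      z * szegoFun a z n - conj (a n) * szegoStarFun a z n := by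
  have h1 : (szegoNorm a n : ℂ) ≠ 0 := by exact_mod_cast (szegoNorm_pos ha n).ne'
  have h2 : (Real.sqrt (1 - ‖a n‖ ^ 2) : ℂ) ≠ 0 := by
    exact_mod_cast (sqrt_one_sub_pos (ha n)).ne'
  rw [szegoFun, szegoFun, szegoStarFun, szegoNorm_succ ha, szego_succ]
  simp only [eval_sub, eval_mul, eval_X, eval_C]
  push_cast
  field_simp

lemma szegoStarFun_succ {a : ℕ → ℂ} (ha : ∀ n, ‖a n‖ < 1) (z : ℂ) (n : ℕ) :
    (Real.sqrt (1 - ‖a n‖ ^ 2) : ℂ) * szegoStarFun a z (n + 1) =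
      szegoStarFun a z n - a n * (z * szegoFun a z n) := by
  have h1 : (szegoNorm a n : ℂ) ≠ 0 := by exact_mod_cast (szegoNorm_pos ha n).ne'
  have h2 : (Real.sqrt (1 - ‖a n‖ ^ 2) : ℂ) ≠ 0 := by
    exact_mod_cast (sqrt_one_sub_pos (ha n)).ne'
  rw [szegoStarFun, szegoFun, szegoStarFun, szegoNorm_succ ha, szegoStar_succ]
  simp only [eval_sub, eval_mul, eval_X, eval_C]
  push_cast
  field_simp

lemma norm_szegoStarFun (a : ℕ → ℂ) {z : ℂ} (hz : ‖z‖ = 1) (n : ℕ) :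
    ‖szegoStarFun a z n‖ = ‖szegoFun a z n‖ := by
  rw [szegoStarFun, szegoFun, norm_div, norm_div, norm_szegoStar_eval a n hz]

lemma opVec_eq_szegoFun {m : Measure Circle} [IsProbabilityMeasure m] {a : ℕ → ℂ}
    (ha : ∀ n, ‖a n‖ < 1) (h : ∀ n, IsOrth m a n) (z : ℂ) : opVec m z = szegoFun a z :=
  funext fun n => opVec_eq m ha h z n

lemma prod_sieveCoeff {p : ℕ} (hp : 0 < p) (a : ℕ → ℂ) (n : ℕ) {j : ℕ} (hj : j < p) :
    ∏ k ∈ Finset.range (n * p + j), (1 - ‖sieveCoeff p a k‖ ^ 2) =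
      ∏ k ∈ Finset.range n, (1 - ‖a k‖ ^ 2) := by
  induction n generalizing j with
  | zero =>
    induction j with
    | zero => simp
    | succ j ihj =>
      rw [← add_assoc, Finset.prod_range_succ, ihj (by omega), sieveCoeff_of_lt a 0 hj]; simp
  | succ n ih =>
    induction j with
    | zero =>
      have h : (n + 1) * p + 0 = n * p + (p - 1) + 1 := by rw [add_mul]; omega
      rw [h, Finset.prod_range_succ, ih (by omega), sieveCoeff_last hp, Finset.prod_range_succ]
    | succ j ihj =>
      rw [← add_assoc, Finset.prod_range_succ, ihj (by omega), sieveCoeff_of_lt a (n + 1) hj]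
      simp

lemma norm_szegoFun_sieveCoeff {p : ℕ} (hp : 0 < p) (a : ℕ → ℂ) {w : ℂ} (hw : ‖w‖ = 1) (N : ℕ) :
    ‖szegoFun (sieveCoeff p a) w N‖ = ‖szegoFun a (w ^ p) (N / p)‖ := by
  have hj := Nat.mod_lt N hp
  conv_lhs => rw [← Nat.div_add_mod' N p]
  rw [szegoFun, szegoFun, szegoNorm, szegoNorm, prod_sieveCoeff hp a _ hj,
    (szego_sieveCoeff hp a _ hj).1]
  simp [hw, expand_eval]

/-! ### The Christoffel–Darboux formula for two Alexandrov measures -/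

/-- Since `|λ| = 1`, the pair `(φ_n, λ̄ φ_n^*)` built from `λα` obeys the recursion for `α`. The
usual Christoffel–Darboux telescoping therefore applies, and `1 - λ̄` compensates the boundary term
at `n = 0`. -/
lemma sum_conj_szegoFun_mul {a : ℕ → ℂ} (ha : ∀ n, ‖a n‖ < 1) {lam : ℂ} (hlam : ‖lam‖ = 1)
    (u w : ℂ) (n : ℕ) :
    (1 - conj u * w) * ∑ j ∈ Finset.range n,
        conj (szegoFun a u j) * szegoFun (fun k => lam * a k) w j =
      conj (szegoStarFun a u n) * (conj lam * szegoStarFun (fun k => lam * a k) w n) -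
        conj (szegoFun a u n) * szegoFun (fun k => lam * a k) w n + (1 - conj lam) := by
  have hnorm : ∀ k, ‖lam * a k‖ = ‖a k‖ := fun k => by rw [norm_mul, hlam, one_mul]
  have hla : ∀ k, ‖(fun k => lam * a k) k‖ < 1 := fun k => by simpa [hlam] using ha k
  have hl := mul_conj_eq_one hlam
  induction n with
  | zero => simp [szegoFun, szegoStarFun, szegoNorm]
  | succ n ih =>
    rw [Finset.sum_range_succ, mul_add, ih]
    have e1 := congrArg conj (szegoFun_succ ha u n)
    have e2 := congrArg conj (szegoStarFun_succ ha u n)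
    have e3 := szegoFun_succ hla w n
    have e4 := szegoStarFun_succ hla w n
    simp only [hnorm, map_mul, map_sub, Complex.conj_conj, Complex.conj_ofReal] at e1 e2 e3 e4
    set r : ℂ := (Real.sqrt (1 - ‖a n‖ ^ 2) : ℂ) with hr
    have hr0 : r ≠ 0 := Complex.ofReal_ne_zero.2 (sqrt_one_sub_pos (ha n)).ne'
    have hr2 : r * r = 1 - a n * conj (a n) := by
      rw [hr, ← Complex.ofReal_mul, Real.mul_self_sqrt (by nlinarith [ha n, norm_nonneg (a n)]),
        Complex.mul_conj, Complex.normSq_eq_norm_sq]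
      push_cast; ring
    apply mul_left_cancel₀ (mul_ne_zero hr0 hr0)
    set P := conj (szegoFun a u (n + 1))
    set P' := conj (szegoStarFun a u (n + 1))
    set Q := szegoFun (fun k => lam * a k) w (n + 1)
    set Q' := szegoStarFun (fun k => lam * a k) w (n + 1)
    have e : r * r * (P' * (conj lam * Q') - P * Q + (1 - conj lam)) =
        (r * P') * (conj lam * (r * Q')) - (r * P) * (r * Q) + r * r * (1 - conj lam) := by ring
    rw [e, e1, e2, e3, e4, hr2]
    linear_combination (a n * w * szegoFun (fun k => lam * a k) w n *
      (conj (szegoStarFun a u n) - conj (a n) * conj u * conj (szegoFun a u n))) * hl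

/-! ### Boundedness away from `1` -/

/-- The quadratic form preserved by a step of the Szegő recursion. -/
def energy (z α x y : ℂ) : ℝ := ‖1 - z‖ ^ 2 * ‖x‖ ^ 2 + 2 * (α * (1 - z) * (x * conj y)).re

lemma coe_energy (z α x y : ℂ) : (energy z α x y : ℂ) =
    (1 - z) * (1 - conj z) * (x * conj x) + α * (1 - z) * (x * conj y) +
      conj α * (1 - conj z) * (conj x * y) := by
  have h1 : ∀ w : ℂ, ((‖w‖ ^ 2 : ℝ) : ℂ) = w * conj w := fun w => by
    rw [Complex.mul_conj, Complex.normSq_eq_norm_sq]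
  have h2 : ((2 * (α * (1 - z) * (x * conj y)).re : ℝ) : ℂ) =
      α * (1 - z) * (x * conj y) + conj (α * (1 - z) * (x * conj y)) := by
    rw [Complex.add_conj]
  rw [energy, Complex.ofReal_add, Complex.ofReal_mul, h1, h1, h2]
  simp only [map_mul, map_sub, map_one, Complex.conj_conj]
  ring

/-- Let `T` be the normalized step matrix and `J = diag(1, -1)`. Then `T* J T = J`, so `v* J T v` is
unchanged by `v ↦ T v`. For `v = (x, y)` with `|x| = |y|`, multiplying this form by `r (z̄ - 1)`
gives `energy`. -/
lemma energy_step {z α x y x' y' : ℂ} {r : ℝ} (hz : ‖z‖ = 1) (hxy : ‖y‖ = ‖x‖) (hr0 : r ≠ 0)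
    (hr : r ^ 2 = 1 - ‖α‖ ^ 2) (hx : (r : ℂ) * x' = z * x - conj α * y)
    (hy : (r : ℂ) * y' = y - α * (z * x)) : energy z α x' y' = energy z α x y := by
  have h0 : (r : ℂ) ≠ 0 := by exact_mod_cast hr0
  have hzz := mul_conj_eq_one hz
  have hxx : x * conj x = y * conj y := by
    rw [Complex.mul_conj, Complex.mul_conj, Complex.normSq_eq_norm_sq, Complex.normSq_eq_norm_sq,
      hxy]
  have hr2 : (r : ℂ) * r = 1 - α * conj α := by
    rw [Complex.mul_conj, Complex.normSq_eq_norm_sq, ← Complex.ofReal_mul, ← pow_two, hr]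
    push_cast; ring
  have hx' := congrArg conj hx
  have hy' := congrArg conj hy
  simp only [map_mul, map_sub, Complex.conj_conj, Complex.conj_ofReal] at hx' hy'
  apply Complex.ofReal_injective
  rw [coe_energy, coe_energy]
  apply mul_left_cancel₀ (mul_ne_zero h0 h0)
  have e : (r : ℂ) * r * ((1 - z) * (1 - conj z) * (x' * conj x') +
      α * (1 - z) * (x' * conj y') + conj α * (1 - conj z) * (conj x' * y')) =
      (1 - z) * (1 - conj z) * ((r * x') * (r * conj x')) +
      α * (1 - z) * ((r * x') * (r * conj y')) +
      conj α * (1 - conj z) * ((r * conj x') * (r * y')) := by ring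
  rw [e, hx, hy, hx', hy', hr2]
  -- With the conjugates as independent variables, what remains is a polynomial identity modulo
  -- `hzz` and `hxx`.
  clear e hr2 hx hy hx' hy'
  generalize conj z = Z at *
  generalize conj x = X at *
  generalize conj y = Y at *
  generalize conj α = A at *
  grind

lemma abs_re_le {z α x y : ℂ} (hxy : ‖y‖ = ‖x‖) :
    |(α * (1 - z) * (x * conj y)).re| ≤ ‖α‖ * ‖1 - z‖ * ‖x‖ ^ 2 := by
  refine (Complex.abs_re_le_norm _).trans (le_of_eq ?_)
  simp only [norm_mul, Complex.norm_conj, hxy]; ring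

/-- For small `α` the cross term costs at most half of the main term, so the energy controls `|x|²`.
-/
lemma norm_sq_le_energy {z α x y : ℂ} (hα : 4 * ‖α‖ ≤ ‖1 - z‖) (hxy : ‖y‖ = ‖x‖) :
    ‖1 - z‖ ^ 2 / 2 * ‖x‖ ^ 2 ≤ energy z α x y := by
  have h1 := neg_le_of_abs_le (abs_re_le (z := z) (α := α) hxy)
  have h2 : 4 * ‖α‖ * (‖1 - z‖ * ‖x‖ ^ 2) ≤ ‖1 - z‖ * (‖1 - z‖ * ‖x‖ ^ 2) :=
    mul_le_mul_of_nonneg_right hα (by positivity)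
  rw [energy]
  nlinarith

lemma isBoundedSeq_of_eventually {x : ℕ → ℂ} {N : ℕ} {M : ℝ} (h : ∀ n ≥ N, ‖x n‖ ≤ M) :
    IsBoundedSeq x := by
  refine ⟨∑ k ∈ Finset.range N, ‖x k‖ + |M|, fun n => ?_⟩
  rcases lt_or_ge n N with hn | hn
  · have := Finset.single_le_sum (fun k _ => norm_nonneg (x k)) (Finset.mem_range.2 hn)
    linarith [abs_nonneg M]
  · have : 0 ≤ ∑ k ∈ Finset.range N, ‖x k‖ := Finset.sum_nonneg fun k _ => norm_nonneg _
    linarith [h n hn, le_abs_self M]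

/-- For Verblunsky coefficients `lam * a_n` with `a_n` decreasing to `0`, the orthonormal
polynomials are bounded at every point of the circle other than `1`. -/
lemma isBoundedSeq_szegoFun {a : ℕ → ℝ} (ha0 : ∀ n, 0 ≤ a n) (ha1 : ∀ n, a n < 1)
    (hanti : Antitone a) (hlim : Tendsto a atTop (𝓝 0)) {lam z : ℂ} (hlam : ‖lam‖ = 1)
    (hz : ‖z‖ = 1) (hz1 : z ≠ 1) : IsBoundedSeq (szegoFun (fun k => lam * (a k : ℂ)) z) := by
  set α : ℕ → ℂ := fun k => lam * (a k : ℂ) with hα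
  have hnorm : ∀ k, ‖α k‖ = a k := fun k => by
    rw [hα]; simp [hlam, abs_of_nonneg (ha0 k)]
  have hlt : ∀ k, ‖α k‖ < 1 := fun k => by rw [hnorm]; exact ha1 k
  set x := szegoFun α z
  set y := szegoStarFun α z
  have hxy : ∀ n, ‖y n‖ = ‖x n‖ := fun n => norm_szegoStarFun α hz n
  set δ := ‖1 - z‖ with hδ
  have hδ0 : 0 < δ := norm_pos_iff.2 (sub_ne_zero.2 hz1.symm)
  obtain ⟨N, hN⟩ : ∃ N, ∀ n ≥ N, 4 * a n ≤ δ := by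
    have := hlim.eventually (gt_mem_nhds (show (0 : ℝ) < δ / 4 by positivity))
    obtain ⟨N, hN⟩ := eventually_atTop.1 this
    exact ⟨N, fun n hn => by linarith [hN n hn]⟩
  set E : ℕ → ℝ := fun n => energy z (α n) (x n) (y n) with hE
  have hlow : ∀ n ≥ N, δ ^ 2 / 2 * ‖x n‖ ^ 2 ≤ E n := fun n hn =>
    norm_sq_le_energy (by rw [hnorm]; exact hN n hn) (hxy n)
  -- The step with `α n` preserves the form built from `α n`. The energy changes only when `α n` is
  -- replaced by `α (n + 1)`, at a relative cost proportional to `a n - a (n + 1)`.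
  have hstep : ∀ n ≥ N, E (n + 1) ≤ E n * (1 + 4 / δ * (a n - a (n + 1))) := by
    intro n hn
    have hpres : energy z (α n) (x (n + 1)) (y (n + 1)) = E n := by
      refine energy_step (r := Real.sqrt (1 - ‖α n‖ ^ 2)) hz (hxy n)
        (sqrt_one_sub_pos (hlt n)).ne' (Real.sq_sqrt ?_) (szegoFun_succ hlt z n)
        (szegoStarFun_succ hlt z n)
      nlinarith [hlt n, norm_nonneg (α n)]
    have hlow' : δ ^ 2 / 2 * ‖x (n + 1)‖ ^ 2 ≤ E n := by
      rw [← hpres]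
      exact norm_sq_le_energy (by rw [hnorm]; exact hN n hn) (hxy (n + 1))
    have hd : 0 ≤ a n - a (n + 1) := sub_nonneg.2 (hanti n.le_succ)
    have hdiff : E (n + 1) - E n =
        2 * ((α (n + 1) - α n) * (1 - z) * (x (n + 1) * conj (y (n + 1)))).re := by
      rw [← hpres, hE]
      simp only [energy, sub_mul, Complex.sub_re]
      ring
    have hbd := le_of_abs_le (abs_re_le (z := z) (α := α (n + 1) - α n) (hxy (n + 1)))
    have hαd : ‖α (n + 1) - α n‖ = a n - a (n + 1) := by
      have : α (n + 1) - α n = lam * ((a (n + 1) - a n : ℝ) : ℂ) := by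
        rw [hα]; push_cast; ring
      rw [this, norm_mul, hlam, one_mul, Complex.norm_real, Real.norm_eq_abs,
        abs_of_nonpos (by linarith)]
      ring
    rw [hαd, ← hδ] at hbd
    have h3 : (a n - a (n + 1)) * δ * ‖x (n + 1)‖ ^ 2 ≤ 2 / δ * (a n - a (n + 1)) * E n := by
      have := mul_le_mul_of_nonneg_left hlow' (show 0 ≤ 2 / δ * (a n - a (n + 1)) by positivity)
      refine le_trans (le_of_eq ?_) this
      field_simp
    have h4 : E n * (1 + 4 / δ * (a n - a (n + 1))) =
        E n + 2 * (2 / δ * (a n - a (n + 1)) * E n) := by ring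
    rw [h4]; linarith
  have hEnn : ∀ n ≥ N, 0 ≤ E n := fun n hn => le_trans (by positivity) (hlow n hn)
  -- Monotonicity makes the increments telescope: `E n * exp(4 a_n / δ)` is nonincreasing.
  have hG : ∀ n ≥ N, E n * Real.exp (4 / δ * a n) ≤ E N * Real.exp (4 / δ * a N) := by
    intro n hn
    induction n, hn using Nat.le_induction with
    | base => exact le_rfl
    | succ n hn ih =>
      refine le_trans ?_ ih
      have h5 : 1 + 4 / δ * (a n - a (n + 1)) ≤ Real.exp (4 / δ * (a n - a (n + 1))) := by
        rw [add_comm]; exact Real.add_one_le_exp _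
      calc E (n + 1) * Real.exp (4 / δ * a (n + 1))
          ≤ E n * (1 + 4 / δ * (a n - a (n + 1))) * Real.exp (4 / δ * a (n + 1)) := by
            gcongr; exact hstep n hn
        _ ≤ E n * Real.exp (4 / δ * (a n - a (n + 1))) * Real.exp (4 / δ * a (n + 1)) := by
            gcongr; exact hEnn n hn
        _ = E n * Real.exp (4 / δ * a n) := by
            rw [mul_assoc, ← Real.exp_add]; congr 2; ring
  set G := E N * Real.exp (4 / δ * a N)
  refine isBoundedSeq_of_eventually (N := N) (M := Real.sqrt (2 * G / δ ^ 2)) fun n hn => ?_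
  refine Real.le_sqrt_of_sq_le ?_
  rw [le_div_iff₀ (by positivity)]
  have h6 : E n ≤ G := by
    refine le_trans ?_ (hG n hn)
    exact le_mul_of_one_le_right (hEnn n hn) (Real.one_le_exp (by have := ha0 n; positivity))
  nlinarith [hlow n hn]

/-! ### Decay at `1` -/

lemma szego_eval_one (a : ℕ → ℝ) (n : ℕ) :
    (szego (fun k => (a k : ℂ)) n).eval 1 = ∏ k ∈ Finset.range n, (1 - (a k : ℂ)) ∧
      (szegoStar (fun k => (a k : ℂ)) n).eval 1 = ∏ k ∈ Finset.range n, (1 - (a k : ℂ)) := by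
  induction n with
  | zero => simp
  | succ n ih =>
    rw [szego_succ, szegoStar_succ, Finset.prod_range_succ]
    simp only [eval_sub, eval_mul, eval_X, eval_C, ih.1, ih.2, Complex.conj_ofReal]
    exact ⟨by ring, by ring⟩

lemma norm_szegoFun_one_sq {a : ℕ → ℝ} (ha : ∀ n, |a n| < 1) (n : ℕ) :
    ‖szegoFun (fun k => (a k : ℂ)) 1 n‖ ^ 2 =
      ∏ k ∈ Finset.range n, ((1 - a k) / (1 + a k)) := by
  have hlt : ∀ k, ‖((fun k => (a k : ℂ)) k)‖ < 1 := fun k => by simpa using ha k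
  rw [szegoFun, (szego_eval_one a n).1, norm_div, div_pow, Complex.norm_real, Real.norm_eq_abs,
    sq_abs, szegoNorm, Real.sq_sqrt (prod_one_sub_pos hlt n).le, norm_prod, ← Finset.prod_pow,
    ← Finset.prod_div_distrib]
  refine Finset.prod_congr rfl fun k _ => ?_
  have h1 := abs_lt.1 (ha k)
  have h2 : ‖(1 - (a k : ℂ))‖ ^ 2 = (1 - a k) ^ 2 := by
    rw [← Complex.ofReal_one, ← Complex.ofReal_sub, Complex.norm_real, Real.norm_eq_abs, sq_abs]
  rw [h2, Complex.norm_real, Real.norm_eq_abs, sq_abs, div_eq_div_iff (by nlinarith) (by linarith)]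
  ring

lemma jacobiCoeff_pos {b : ℝ} (hb : -1 / 2 < b) (hb' : b < 0) (n : ℕ) : 0 < jacobiCoeff b n := by
  have : (0 : ℝ) ≤ n := n.cast_nonneg
  exact div_pos (by linarith) (by linarith)

lemma jacobiCoeff_lt_one {b : ℝ} (hb : -1 / 2 < b) (n : ℕ) : jacobiCoeff b n < 1 := by
  have : (0 : ℝ) ≤ n := n.cast_nonneg
  rw [jacobiCoeff, div_lt_one (by linarith)]
  linarith

lemma jacobiCoeff_antitone {b : ℝ} (hb : -1 / 2 < b) (hb' : b < 0) :
    Antitone (jacobiCoeff b) := by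
  intro k n hkn
  have h1 : (k : ℝ) ≤ n := by exact_mod_cast hkn
  have h2 : (0 : ℝ) ≤ k := k.cast_nonneg
  exact div_le_div_of_nonneg_left (by linarith) (by linarith) (by linarith)

lemma tendsto_jacobiCoeff (b : ℝ) : Tendsto (jacobiCoeff b) atTop (𝓝 0) := by
  have h : Tendsto (fun n : ℕ => (n : ℝ) + 1 + b) atTop atTop :=
    tendsto_atTop_add_const_right _ _ (tendsto_atTop_add_const_right _ _
      tendsto_natCast_atTop_atTop)
  exact h.const_div_atTop (-b)

/-- Here `(1 - a_k)/(1 + a_k) = 1 + 2b/(k+1) ≤ exp(2b/(k+1))`, and the harmonic series diverges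
while `b < 0`. -/
lemma tendsto_szegoFun_one {b : ℝ} (hb : -1 / 2 < b) (hb' : b < 0) :
    Tendsto (fun n => ‖szegoFun (fun k => (jacobiCoeff b k : ℂ)) 1 n‖) atTop (𝓝 0) := by
  have habs : ∀ n, |jacobiCoeff b n| < 1 := fun n => by
    rw [abs_of_pos (jacobiCoeff_pos hb hb' n)]; exact jacobiCoeff_lt_one hb n
  have hsq : Tendsto (fun n => ‖szegoFun (fun k => (jacobiCoeff b k : ℂ)) 1 n‖ ^ 2) atTop
      (𝓝 0) := by
    have hexp : Tendsto (fun n : ℕ => Real.exp (2 * b * ∑ k ∈ Finset.range n, 1 / ((k : ℝ) + 1)))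
        atTop (𝓝 0) :=
      Real.tendsto_exp_atBot.comp ((tendsto_const_mul_atBot_of_neg (by linarith)).2
        Real.tendsto_sum_range_one_div_nat_succ_atTop)
    refine squeeze_zero (fun n => by positivity) (fun n => ?_) hexp
    rw [norm_szegoFun_one_sq habs, Finset.mul_sum, Real.exp_sum]
    refine Finset.prod_le_prod (fun k _ => ?_) fun k _ => ?_
    · have h1 := abs_lt.1 (habs k)
      exact div_nonneg (by linarith) (by linarith)
    · have h0 : (0 : ℝ) ≤ k := k.cast_nonneg
      have h1 : (k : ℝ) + 1 + b ≠ 0 := by linarith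
      have h2 : (k : ℝ) + 1 ≠ 0 := by linarith
      have h3 : (1 - jacobiCoeff b k) / (1 + jacobiCoeff b k) = 2 * b * (1 / ((k : ℝ) + 1)) + 1 := by
        have h4 : 1 + jacobiCoeff b k = ((k : ℝ) + 1) / (k + 1 + b) := by
          rw [jacobiCoeff]; field_simp; ring
        have h5 : 1 - jacobiCoeff b k = ((k : ℝ) + 1 + 2 * b) / (k + 1 + b) := by
          rw [jacobiCoeff]; field_simp; ring
        rw [h4, h5]; field_simp; ring
      rw [h3]
      exact Real.add_one_le_exp _
  have := hsq.sqrt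
  simpa [Real.sqrt_sq (norm_nonneg _)] using this

/-! ### The inner products -/

lemma isOrth_sieve_sinMeasure {b : ℝ} (hb : -1 / 2 < b) (hb' : b < 0) {p : ℕ} (hp : 0 < p)
    (n : ℕ) :
    IsOrth (sieve p (sinMeasure b)) (sieveCoeff p fun k => (jacobiCoeff b k : ℂ)) n := by
  have := isProbabilityMeasure_sinMeasure hb hb'
  exact isOrth_sieve hp (isOrth_sinMeasure hb hb') n

lemma norm_jacobiCoeff_lt_one {b : ℝ} (hb : -1 / 2 < b) (hb' : b < 0) (n : ℕ) :
    ‖(jacobiCoeff b n : ℂ)‖ < 1 := by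
  rw [Complex.norm_real, Real.norm_of_nonneg (jacobiCoeff_pos hb hb' n).le]
  exact jacobiCoeff_lt_one hb n

lemma opVec_sieve_sinMeasure {b : ℝ} (hb : -1 / 2 < b) (hb' : b < 0) {p : ℕ} (hp : 0 < p)
    (z : ℂ) : opVec (sieve p (sinMeasure b)) z =
      szegoFun (sieveCoeff p fun k => (jacobiCoeff b k : ℂ)) z := by
  have := isProbabilityMeasure_sinMeasure hb hb'
  have := isProbabilityMeasure_sieve hp (sinMeasure b)
  exact opVec_eq_szegoFun (norm_sieveCoeff_lt p (norm_jacobiCoeff_lt_one hb hb'))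
    (isOrth_sieve_sinMeasure hb hb' hp) z

lemma verblunsky_sieve_sinMeasure {b : ℝ} (hb : -1 / 2 < b) (hb' : b < 0) {p : ℕ} (hp : 0 < p)
    (n : ℕ) : verblunsky (sieve p (sinMeasure b)) n =
      sieveCoeff p (fun k => (jacobiCoeff b k : ℂ)) n := by
  have := isProbabilityMeasure_sinMeasure hb hb'
  have := isProbabilityMeasure_sieve hp (sinMeasure b)
  exact verblunsky_eq _ (norm_sieveCoeff_lt p (norm_jacobiCoeff_lt_one hb hb'))
    (isOrth_sieve_sinMeasure hb hb' hp) n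

lemma exists_isAlexandrov {b : ℝ} (hb : -1 / 2 < b) (hb' : b < 0) {p : ℕ} (hp : 0 < p)
    {lam : ℂ} (hlam : ‖lam‖ = 1) : ∃ m, IsAlexandrov (sieve p (sinMeasure b)) lam m := by
  refine exists_isNontrivialProb fun n => ?_
  rw [verblunsky_sieve_sinMeasure hb hb' hp, norm_mul, hlam, one_mul]
  exact norm_sieveCoeff_lt p (norm_jacobiCoeff_lt_one hb hb') n

lemma norm_eq_one_of_pow {p : ℕ} (hp : 0 < p) {u : ℂ} (hu : u ^ p = 1) : ‖u‖ = 1 :=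
  Complex.norm_eq_one_of_pow_eq_one hu hp.ne'

lemma tendsto_opVec_sieve_sinMeasure {b : ℝ} (hb : -1 / 2 < b) (hb' : b < 0) {p : ℕ}
    (hp : 0 < p) {u : ℂ} (hu : u ^ p = 1) :
    Tendsto (fun n => ‖opVec (sieve p (sinMeasure b)) u n‖) atTop (𝓝 0) := by
  have h := (tendsto_szegoFun_one hb hb').comp (Nat.tendsto_div_const_atTop hp.ne')
  refine h.congr fun n => ?_
  rw [opVec_sieve_sinMeasure hb hb' hp, norm_szegoFun_sieveCoeff hp _ (norm_eq_one_of_pow hp hu),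
    hu]
  rfl

lemma isBoundedSeq_opVec_sieve_sinMeasure {b : ℝ} (hb : -1 / 2 < b) (hb' : b < 0) {p : ℕ}
    (hp : 0 < p) {u : ℂ} (hu : u ^ p = 1) :
    IsBoundedSeq (opVec (sieve p (sinMeasure b)) u) := by
  obtain ⟨N, hN⟩ := eventually_atTop.1 ((tendsto_opVec_sieve_sinMeasure hb hb' hp hu).eventually
    (gt_mem_nhds one_pos))
  exact isBoundedSeq_of_eventually fun n hn => (hN n hn).le

section

variable {b : ℝ} {p : ℕ} {lam : ℂ} {m : Measure Circle}

/-- The Szegő recursion recovers the polynomials from the coefficients, so every measure satisfying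
`IsAlexandrov` yields the same vectors and uniqueness of the measure is not needed. -/
lemma opVec_alexandrov (hb : -1 / 2 < b) (hb' : b < 0) (hp : 0 < p) (hlam : ‖lam‖ = 1)
    (hm : IsAlexandrov (sieve p (sinMeasure b)) lam m) (z : ℂ) :
    opVec m z =
      szegoFun (fun n => lam * sieveCoeff p (fun k => (jacobiCoeff b k : ℂ)) n) z := by
  have := hm.1.1
  have hv : verblunsky m = fun n => lam * sieveCoeff p (fun k => (jacobiCoeff b k : ℂ)) n :=
    funext fun n => by rw [hm.2, verblunsky_sieve_sinMeasure hb hb' hp]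
  rw [← hv]
  refine opVec_eq_szegoFun (fun n => ?_) (isOrth_verblunsky hm.1) z
  rw [hv, norm_mul, hlam, one_mul]
  exact norm_sieveCoeff_lt p (norm_jacobiCoeff_lt_one hb hb') n

lemma isBoundedSeq_opVec_alexandrov (hb : -1 / 2 < b) (hb' : b < 0) (hp : 0 < p)
    (hlam : ‖lam‖ = 1) (hm : IsAlexandrov (sieve p (sinMeasure b)) lam m) {w : ℂ}
    (hw : ‖w‖ = 1) (hwp : w ^ p ≠ 1) : IsBoundedSeq (opVec m w) := by
  obtain ⟨M, hM⟩ := isBoundedSeq_szegoFun (fun n => (jacobiCoeff_pos hb hb' n).le)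
    (jacobiCoeff_lt_one hb) (jacobiCoeff_antitone hb hb') (tendsto_jacobiCoeff b) hlam
    (z := w ^ p) (by simp [hw]) hwp
  refine ⟨M, fun n => ?_⟩
  rw [opVec_alexandrov hb hb' hp hlam hm]
  simp_rw [mul_sieveCoeff]
  rw [norm_szegoFun_sieveCoeff hp _ hw]
  exact hM _

/-- The inner product of `φ(u; μ)` with `φ(w; μ^(lam))`. -/
lemma hasInner_opVec_alexandrov (hb : -1 / 2 < b) (hb' : b < 0) (hp : 0 < p)
    (hlam : ‖lam‖ = 1) (hm : IsAlexandrov (sieve p (sinMeasure b)) lam m) {u w : ℂ}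
    (hu : u ^ p = 1) (hw : ‖w‖ = 1) (hwp : w ^ p ≠ 1) :
    HasInner (opVec (sieve p (sinMeasure b)) u) (opVec m w)
      ((1 - conj lam) / (1 - conj u * w)) := by
  obtain ⟨M, hM⟩ := isBoundedSeq_opVec_alexandrov hb hb' hp hlam hm hw hwp
  have hlim := tendsto_opVec_sieve_sinMeasure hb hb' hp hu
  have hu1 := norm_eq_one_of_pow hp hu
  rw [opVec_sieve_sinMeasure hb hb' hp] at hlim ⊢
  rw [opVec_alexandrov hb hb' hp hlam hm] at hM ⊢
  set a := sieveCoeff p fun k => (jacobiCoeff b k : ℂ)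
  have ha : ∀ n, ‖a n‖ < 1 := norm_sieveCoeff_lt p (norm_jacobiCoeff_lt_one hb hb')
  have hne : 1 - conj u * w ≠ 0 := by
    intro h
    have h1 : w = u := by
      linear_combination (-w) * mul_conj_eq_one hu1 - u * h
    exact hwp (h1 ▸ hu)
  -- A null sequence times a bounded one; this kills both products in the Christoffel–Darboux
  -- boundary term.
  have hzero : ∀ x y : ℕ → ℂ, (∀ n, ‖x n‖ = ‖szegoFun a u n‖) → (∀ n, ‖y n‖ ≤ M) →
      Tendsto (fun n => conj (x n) * y n) atTop (𝓝 0) := by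
    intro x y hx hy
    refine squeeze_zero_norm (a := fun n => ‖szegoFun a u n‖ * M) (fun n => ?_) ?_
    · rw [norm_mul, Complex.norm_conj, hx]
      exact mul_le_mul_of_nonneg_left (hy n) (norm_nonneg _)
    · simpa using hlim.mul_const M
  have h1 := hzero (szegoStarFun a u) (fun n => conj lam * szegoStarFun (fun k => lam * a k) w n)
    (norm_szegoStarFun a hu1) fun n => by
      rw [norm_mul, Complex.norm_conj, hlam, one_mul, norm_szegoStarFun _ hw]; exact hM n
  have h2 := hzero (szegoFun a u) _ (fun _ => rfl) hM
  have h3 := (((h1.sub h2).add_const (1 - conj lam)).div_const (1 - conj u * w))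
  rw [sub_zero, zero_add] at h3
  refine h3.congr fun n => ?_
  rw [← sum_conj_szegoFun_mul ha hlam, mul_div_cancel_left₀ _ hne]

end

end OPUC

end

theorem theorem4p5 (b : ℝ) (hb : -1 / 2 < b) (hb' : b < 0) (p : ℕ) (hp : 0 < p)
    (lam : ℂ) (hlam : ‖lam‖ = 1) (hlam1 : lam ≠ 1) (hlam2 : lam ≠ -1) :
    (∃ m, OPUC.IsAlexandrov (OPUC.sieve p (OPUC.sinMeasure b)) lam m) ∧
    (∃ m, OPUC.IsAlexandrov (OPUC.sieve p (OPUC.sinMeasure b)) (conj lam) m) ∧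
    ∀ μl μl' : Measure Circle,
      OPUC.IsAlexandrov (OPUC.sieve p (OPUC.sinMeasure b)) lam μl →
      OPUC.IsAlexandrov (OPUC.sieve p (OPUC.sinMeasure b)) (conj lam) μl' →
      ∀ u : ℂ, u ^ p = 1 →
        OPUC.IsBalanced (OPUC.opVec (OPUC.sieve p (OPUC.sinMeasure b)) u)
          (fun w : {w : ℂ // ‖w‖ = 1 ∧ w ^ p ≠ 1} => OPUC.opVec μl w)
          (fun w : {w : ℂ // ‖w‖ = 1 ∧ w ^ p ≠ 1} => OPUC.opVec μl' w) := by
  have hlam' : ‖conj lam‖ = 1 := by rw [Complex.norm_conj, hlam]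
  refine ⟨OPUC.exists_isAlexandrov hb hb' hp hlam, OPUC.exists_isAlexandrov hb hb' hp hlam',
    fun μl μl' hμ hμ' u hu => ⟨OPUC.isBoundedSeq_opVec_sieve_sinMeasure hb hb' hp hu,
      fun w => OPUC.isBoundedSeq_opVec_alexandrov hb hb' hp hlam hμ w.2.1 w.2.2,
      fun w => OPUC.isBoundedSeq_opVec_alexandrov hb hb' hp hlam' hμ' w.2.1 w.2.2,
      fun w => (1 - conj lam) / (1 - conj u * w),
      fun w => (1 - conj (conj lam)) / (1 - conj u * w),
      fun w => OPUC.hasInner_opVec_alexandrov hb hb' hp hlam hμ hu w.2.1 w.2.2,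
      fun w => OPUC.hasInner_opVec_alexandrov hb hb' hp hlam' hμ' hu w.2.1 w.2.2, ?_⟩⟩
  -- The moduli agree at each `w` individually, so the two ranges coincide without reindexing.
  congr 1
  funext w
  have h : ‖1 - conj lam‖ = ‖1 - conj (conj lam)‖ := by
    rw [← Complex.norm_conj]; simp
  rw [norm_div, norm_div, h]
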